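/- There are two teams $1,2$ and $m$ players. Each team $i$ has an additive valuation $v_i$ over sets of players, with real values $v_i(p)$ of arbitrary sign, and each player $p$ has a weak order (complete and transitive) $\succsim_p$ over the two teams. An allocation is an ordered partition $(A_1,A_2)$ of the set of players. Say that team $i$ does not envy team $j$ by more than one player if $v_i(A_i\setminus X)\ge v_i(A_j\setminus Y)$ for some $X\subseteq A_i$, $Y\subseteq A_j$ with $|X\cup Y|\le 1$. The allocation is EF1 if this holds for all $i\ne j$. It is PO if no allocation makes some team or player better off and no team or player worse off; it is team-PO if no allocation makes some team better off and no team worse off. Consider the following procedure. (a) Assign each player with $v_1(p)=v_2(p)=0$ to a team that she weakly prefers to the other one, breaking ties arbitrarily. Among the remaining players, let $P_1^*=\{p: v_1(p)\ge 0\ge v_2(p)\}$, $P_2^*=\{p: v_1(p)\le 0\le v_2(p)\}$, $P^+=\{p: v_1(p)>0,\ v_2(p)>0\}$ and $P^-=\{p: v_1(p)<0,\ v_2(p)<0\}$. (b) List the players of $P^+\cup P^-$ as $p_1,\dots,p_r$ by nondecreasing ratio $|v_1(p)|/|v_2(p)|$. Among players with the same ratio, first come those in $P^+$ who strictly prefer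 team $2$ and those in $P^-$ who strictly prefer team $1$, then those who like both teams equally, then those in $P^+$ who strictly prefer team $1$ and those in $P^-$ who strictly prefer team $2$; remaining ties are broken arbitrarily. (c) Give $P^+\cup P_1^*$ to team $1$ and $P^-\cup P_2^*$ to team $2$. For $i=1,\dots,r$: stop if team $2$ does not envy team $1$ by more than one player; otherwise move $p_i$ to the other team. Then, for every instance with two teams, every possible output of this procedure is EF1, PO and team-PO. Moreover, the procedure can be carried out in time $O(m^2)$: there is a single program for a real random access machine (unit cost per memory access, arithmetic operation, comparison and control step) which, on every instance with two teams and $m$ players, halts within $O(m^2)$ steps with an output of the procedure, hence with an allocation that is EF1, PO and team-PO. -/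

import Mathlib

namespace TeamAllocation

/-! ## Instances and allocations -/

/-- An instance with `n` teams and `m` players. `v i p` is the value of team `i` for player `p`, of
arbitrary sign; `pref p i j` says that player `p` finds team `i` at least as good as team `j`. -/
structure AllocInstance (n m : ℕ) where
  v : Fin n → Fin m → ℝ
  pref : Fin m → Fin n → Fin n → Prop
  pref_total : ∀ p i j, pref p i j ∨ pref p j i
  pref_trans : ∀ p i j k, pref p i j → pref p j k → pref p i k

/-- An allocation sends each player to her team; equivalently, it is an ordered partition of the
players into `n` (possibly empty) parts. -/
abbrev Allocation (n m : ℕ) := Fin m → Fin n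

/-- The set of players assigned to team `i`. -/
def bundle {n m : ℕ} (A : Allocation n m) (i : Fin n) : Finset (Fin m) :=
  Finset.univ.filter (fun p => A p = i)

namespace AllocInstance

variable {n m : ℕ}

/-- The additive valuation of team `i` on sets of players. -/
def value (I : AllocInstance n m) (i : Fin n) (S : Finset (Fin m)) : ℝ :=
  ∑ p ∈ S, I.v i p

/-- Player `p` strictly prefers team `i` to team `j`. -/
def strictPref (I : AllocInstance n m) (p : Fin m) (i j : Fin n) : Prop :=
  I.pref p i j ∧ ¬ I.pref p j i

/-- Player `p` likes teams `i` and `j` equally. -/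
def indiff (I : AllocInstance n m) (p : Fin m) (i j : Fin n) : Prop :=
  I.pref p i j ∧ I.pref p j i

/-- Team `i` does not envy team `j` by more than one player. -/
def NoEnvyUpToOne (I : AllocInstance n m) (A : Allocation n m) (i j : Fin n) : Prop :=
  ∃ X Y : Finset (Fin m), X ⊆ bundle A i ∧ Y ⊆ bundle A j ∧ (X ∪ Y).card ≤ 1 ∧
    I.value i (bundle A j \ Y) ≤ I.value i (bundle A i \ X)

/-- Envy-freeness up to one player. -/
def EF1 (I : AllocInstance n m) (A : Allocation n m) : Prop :=
  ∀ i j : Fin n, i ≠ j → I.NoEnvyUpToOne A i j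

/-- `A'` Pareto dominates `A`: no party (team or player) is worse off in `A'`, and at least one
party is better off. -/
def ParetoDominates (I : AllocInstance n m) (A' A : Allocation n m) : Prop :=
  (∀ i, I.value i (bundle A i) ≤ I.value i (bundle A' i)) ∧
  (∀ p, I.pref p (A' p) (A p)) ∧
  ((∃ i, I.value i (bundle A i) < I.value i (bundle A' i)) ∨
    ∃ p, I.strictPref p (A' p) (A p))

/-- Pareto optimality with respect to all parties. -/
def PO (I : AllocInstance n m) (A : Allocation n m) : Prop :=
  ∀ A' : Allocation n m, ¬ I.ParetoDominates A' A

/-- `A'` team-Pareto dominates `A`: only the teams are taken into account. -/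
def TeamParetoDominates (I : AllocInstance n m) (A' A : Allocation n m) : Prop :=
  (∀ i, I.value i (bundle A i) ≤ I.value i (bundle A' i)) ∧
  ∃ i, I.value i (bundle A i) < I.value i (bundle A' i)

/-- Team-Pareto optimality. -/
def TeamPO (I : AllocInstance n m) (A : Allocation n m) : Prop :=
  ∀ A' : Allocation n m, ¬ I.TeamParetoDominates A' A

end AllocInstance

/-! ## The generalized adjusted winner procedure with tie-breaking by player preferences

Team 1 is the index `0`, team 2 is the index `1`. -/

namespace AllocInstance

variable {m : ℕ}

/-- Both teams have value zero for `p`. -/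
def IsZero (I : AllocInstance 2 m) (p : Fin m) : Prop := I.v 0 p = 0 ∧ I.v 1 p = 0

/-- Both teams have positive value for `p`. -/
def IsPos (I : AllocInstance 2 m) (p : Fin m) : Prop := 0 < I.v 0 p ∧ 0 < I.v 1 p

/-- Both teams have negative value for `p`. -/
def IsNeg (I : AllocInstance 2 m) (p : Fin m) : Prop := I.v 0 p < 0 ∧ I.v 1 p < 0

/-- `p` is not a zero player, and `v₁(p) ≥ 0 ≥ v₂(p)`. -/
def IsStarOne (I : AllocInstance 2 m) (p : Fin m) : Prop :=
  ¬ I.IsZero p ∧ 0 ≤ I.v 0 p ∧ I.v 1 p ≤ 0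

/-- `p` is not a zero player, and `v₁(p) ≤ 0 ≤ v₂(p)`. -/
def IsStarTwo (I : AllocInstance 2 m) (p : Fin m) : Prop :=
  ¬ I.IsZero p ∧ I.v 0 p ≤ 0 ∧ 0 ≤ I.v 1 p

/-- The ratio by which the players valued with the same strict sign by both teams are ordered. -/
noncomputable def ratio (I : AllocInstance 2 m) (p : Fin m) : ℝ := |I.v 0 p| / |I.v 1 p|

open Classical in
/-- The position of a player among the players with the same ratio: first the positive players who
strictly prefer team 2 and the negative ones who strictly prefer team 1, then the players who like
both teams equally, then the positive players who strictly prefer team 1 and the negative ones who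
strictly prefer team 2. -/
noncomputable def tieClass (I : AllocInstance 2 m) (p : Fin m) : ℕ :=
  if (I.IsPos p ∧ I.strictPref p 1 0) ∨ (I.IsNeg p ∧ I.strictPref p 0 1) then 1
  else if I.indiff p 0 1 then 2
  else 3

/-- `l` lists the players valued with the same strict sign by both teams, each exactly once, by
nondecreasing ratio and, among equal ratios, by nondecreasing tie class. Ties that remain are broken
arbitrarily. -/
def IsGAWOrder (I : AllocInstance 2 m) (l : List (Fin m)) : Prop :=
  l.Nodup ∧ (∀ p, p ∈ l ↔ I.IsPos p ∨ I.IsNeg p) ∧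
  l.Pairwise (fun p q => I.ratio p < I.ratio q ∨
    (I.ratio p = I.ratio q ∧ I.tieClass p ≤ I.tieClass q))

/-- `A` is an allocation from which the loop may start: each zero player is in a team that she
weakly prefers to the other team, team 1 has the positive players and the players with
`v₁ ≥ 0 ≥ v₂`, and team 2 has the negative players and the players with `v₁ ≤ 0 ≤ v₂`. -/
def IsGAWStart (I : AllocInstance 2 m) (A : Allocation 2 m) : Prop :=
  ∀ p, (I.IsZero p → ∀ i, I.pref p (A p) i) ∧
    (I.IsPos p ∨ I.IsStarOne p → A p = 0) ∧
    (I.IsNeg p ∨ I.IsStarTwo p → A p = 1)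

open Classical in
/-- The loop: stop as soon as team 2 does not envy team 1 by more than one player; otherwise move
the next player of the list, from team 1 to team 2 if she is positive and from team 2 to team 1 if
she is negative. -/
noncomputable def gawLoop (I : AllocInstance 2 m) : List (Fin m) → Allocation 2 m → Allocation 2 m
  | [], A => A
  | p :: l, A =>
    if I.NoEnvyUpToOne A 1 0 then A
    else gawLoop I l (Function.update A p (if I.IsPos p then 1 else 0))

/-- `A` is a possible output of the procedure, for some way of making the arbitrary choices. -/
def IsGAWOutput (I : AllocInstance 2 m) (A : Allocation 2 m) : Prop :=
  ∃ (l : List (Fin m)) (A₀ : Allocation 2 m),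
    I.IsGAWOrder l ∧ I.IsGAWStart A₀ ∧ A = I.gawLoop l A₀

end AllocInstance

/-! ## A real random access machine with a step count

The memory consists of arrays of natural numbers (used as indices, counters and flags) and arrays of
real numbers. Array names are fixed in the program text, array indices are computed at run time, and
a scalar variable is a cell with constant index. Programs are structured. Every memory access, every
arithmetic operation, every comparison, every logical connective, and every control step costs one
unit. On natural numbers there are only successor and predecessor; on real numbers there are
addition, subtraction and multiplication. -/

/-- Memory: `nat x k` and `real x k` are cell `k` of the array named `x` of each kind. -/
structure Memory where
  nat : ℕ → ℕ → ℕ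
  real : ℕ → ℕ → ℝ

/-- Write a natural number to cell `k` of the array `x`. -/
def Memory.setNat (s : Memory) (x k a : ℕ) : Memory :=
  { s with nat := Function.update s.nat x (Function.update (s.nat x) k a) }

/-- Write a real number to cell `k` of the array `x`. -/
noncomputable def Memory.setReal (s : Memory) (x k : ℕ) (a : ℝ) : Memory :=
  { s with real := Function.update s.real x (Function.update (s.real x) k a) }

/-- Expressions for natural numbers. -/
inductive NatExpr where
  | lit (k : ℕ)
  | read (x : ℕ) (i : NatExpr)
  | succ (e : NatExpr)
  | pred (e : NatExpr)

namespace NatExpr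

/-- Value; the predecessor of `0` is `0`. -/
def eval (s : Memory) : NatExpr → ℕ
  | lit k => k
  | read x i => s.nat x (i.eval s)
  | succ e => e.eval s + 1
  | pred e => e.eval s - 1

/-- Number of elementary operations. -/
def cost : NatExpr → ℕ
  | lit _ => 1
  | read _ i => i.cost + 1
  | succ e => e.cost + 1
  | pred e => e.cost + 1

end NatExpr

/-- Expressions for real numbers. -/
inductive RealExpr where
  | zero
  | one
  | read (x : ℕ) (i : NatExpr)
  | plus (a b : RealExpr)
  | minus (a b : RealExpr)
  | times (a b : RealExpr)

namespace RealExpr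

/-- Value. -/
noncomputable def eval (s : Memory) : RealExpr → ℝ
  | zero => 0
  | one => 1
  | read x i => s.real x (i.eval s)
  | plus a b => a.eval s + b.eval s
  | minus a b => a.eval s - b.eval s
  | times a b => a.eval s * b.eval s

/-- Number of elementary operations. -/
def cost : RealExpr → ℕ
  | zero => 1
  | one => 1
  | read _ i => i.cost + 1
  | plus a b => a.cost + b.cost + 1
  | minus a b => a.cost + b.cost + 1
  | times a b => a.cost + b.cost + 1

end RealExpr

/-- Tests. -/
inductive Test where
  | natLe (a b : NatExpr)
  | realLe (a b : RealExpr)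
  | neg (t : Test)
  | both (t u : Test)

namespace Test

/-- Truth of a test. -/
def eval (s : Memory) : Test → Prop
  | natLe a b => a.eval s ≤ b.eval s
  | realLe a b => a.eval s ≤ b.eval s
  | neg t => ¬ t.eval s
  | both t u => t.eval s ∧ u.eval s

/-- Number of elementary operations. -/
def cost : Test → ℕ
  | natLe a b => a.cost + b.cost + 1
  | realLe a b => a.cost + b.cost + 1
  | neg t => t.cost + 1
  | both t u => t.cost + u.cost + 1

end Test

/-- Programs. -/
inductive Program where
  | skip
  | natStore (x : ℕ) (i e : NatExpr)
  | realStore (x : ℕ) (i : NatExpr) (e : RealExpr)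
  | seq (c d : Program)
  | branch (t : Test) (c d : Program)
  | whileDo (t : Test) (c : Program)

/-- `Exec c s k s'`: started in memory `s`, the program `c` halts in memory `s'` after exactly `k`
steps. -/
inductive Exec : Program → Memory → ℕ → Memory → Prop
  | skip (s : Memory) : Exec Program.skip s 1 s
  | natStore (x : ℕ) (i e : NatExpr) (s : Memory) :
      Exec (Program.natStore x i e) s (i.cost + e.cost + 1) (s.setNat x (i.eval s) (e.eval s))
  | realStore (x : ℕ) (i : NatExpr) (e : RealExpr) (s : Memory) :
      Exec (Program.realStore x i e) s (i.cost + e.cost + 1) (s.setReal x (i.eval s) (e.eval s))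
  | seq {c d : Program} {s s' s'' : Memory} {k l : ℕ} :
      Exec c s k s' → Exec d s' l s'' → Exec (Program.seq c d) s (k + l) s''
  | branchTrue {t : Test} {c : Program} (d : Program) {s s' : Memory} {k : ℕ} :
      t.eval s → Exec c s k s' → Exec (Program.branch t c d) s (t.cost + k + 1) s'
  | branchFalse {t : Test} (c : Program) {d : Program} {s s' : Memory} {k : ℕ} :
      ¬ t.eval s → Exec d s k s' → Exec (Program.branch t c d) s (t.cost + k + 1) s'
  | whileTrue {t : Test} {c : Program} {s s' s'' : Memory} {k l : ℕ} :
      t.eval s → Exec c s k s' → Exec (Program.whileDo t c) s' l s'' →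
      Exec (Program.whileDo t c) s (t.cost + k + l + 1) s''
  | whileFalse {t : Test} (c : Program) {s : Memory} :
      ¬ t.eval s → Exec (Program.whileDo t c) s (t.cost + 1) s

open Classical in
/-- The input memory of a two-team instance. The real arrays `0` and `1` hold the values of team 1
and of team 2 for the players. Cell `0` of the natural-number array `0` holds the number of players;
the natural-number arrays `1` and `2` hold one bit per player, which says whether she finds team 1
at least as good as team 2, and whether she finds team 2 at least as good as team 1. All other cells
hold zero. -/
noncomputable def inputMemory {m : ℕ} (I : AllocInstance 2 m) : Memory where
  nat x k :=
    if x = 0 ∧ k = 0 then m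
    else if h : k < m then
      if x = 1 ∧ I.pref ⟨k, h⟩ 0 1 then 1
      else if x = 2 ∧ I.pref ⟨k, h⟩ 1 0 then 1
      else 0
    else 0
  real x k :=
    if h : k < m then
      if x = 0 then I.v 0 ⟨k, h⟩
      else if x = 1 then I.v 1 ⟨k, h⟩
      else 0
    else 0

/-- The memory `s` holds the allocation `A` as output: cell `p` of the natural-number array `3` is
the index of the team of player `p`. -/
def HoldsOutput {m : ℕ} (s : Memory) (A : Allocation 2 m) : Prop :=
  ∀ p : Fin m, s.nat 3 p = (A p : ℕ)

end TeamAllocation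

open TeamAllocation
open scoped Asymptotics

/-! Fairness. From the point of view of team `i`, a player counts with her value if she is in team
`i` and with minus her value otherwise; call this her `gap`. The gaps of team `i` add up to the
value of its own bundle minus that of the other one, and deleting a player from either bundle
subtracts her gap. Hence team `i` does not envy by more than one player if and only if the sum of
its gaps is at least the minimum of `0` and the gaps (`noEnvyUpToOne_iff`).

The list is ordered by ratio, so some `t > 0` lies between the ratios of the moved players and those
of the players not moved. With weights `1` and `t`, every player is then in a team that values her
most (`gap_nonneg`), so the output maximises a positively weighted sum of the team values. This
gives team-PO. It also gives EF1 for team 1: if team 2 still envied team 1 with the last moved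
player `p` left out, then team 1 cannot envy team 2 with `p` left out (`noEnvy_zero_of_envy`).

For PO, an allocation that makes nobody worse off has the same team values, and it reassigns only
zero players and players of ratio `t` (`changed_gap`, `gap_eq_zero`). If some player is strictly
better off, the tie classes force all reassigned nonzero players to be on the same side of the
stopping point; a team then strictly loses, a contradiction.

Running time. No list is sorted in advance. Each iteration of the main loop makes one pass over the
players, which finds the sum and the minimum of the gaps of team 2 and a player of least key among
those still to be moved. There are at most `m + 1` iterations. The invariant `CanEnd` says that
every way of finishing from the current state yields an output of the procedure. -/

namespace TeamAllocation

namespace AllocInstance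

variable {m : ℕ}

/-! ### Gaps and envy. -/

/-- What player `q` contributes to the value of the own bundle minus the value of the other bundle,
from the point of view of team `i`. -/
noncomputable def gap (I : AllocInstance 2 m) (A : Allocation 2 m) (i : Fin 2) (q : Fin m) : ℝ :=
  if A q = i then I.v i q else -I.v i q

theorem value_bundle_eq_sum {n : ℕ} (I : AllocInstance n m) (A : Allocation n m) (i j : Fin n) :
    I.value i (bundle A j) = ∑ q, if A q = j then I.v i q else 0 := by
  simp [value, bundle, Finset.sum_filter]

theorem sum_gap (I : AllocInstance 2 m) (A : Allocation 2 m) {i j : Fin 2} (hij : i ≠ j) :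
    ∑ q, I.gap A i q = I.value i (bundle A i) - I.value i (bundle A j) := by
  rw [value_bundle_eq_sum, value_bundle_eq_sum, ← Finset.sum_sub_distrib]
  refine Finset.sum_congr rfl fun q _ => ?_
  have : A q = j ↔ ¬ A q = i := by omega
  by_cases h : A q = i <;> simp [gap, this, h, hij]

theorem value_sdiff {n : ℕ} (I : AllocInstance n m) (i : Fin n) {X S : Finset (Fin m)}
    (h : X ⊆ S) : I.value i (S \ X) = I.value i S - I.value i X := by
  have := Finset.sum_sdiff (f := I.v i) h
  simp only [value]
  linarith

/-- As `X ∪ Y` has at most one element, either nothing is deleted or a single player `q` is.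
Deleting `q` from whichever bundle contains her lowers the difference of values by her gap. -/
theorem noEnvyUpToOne_iff (I : AllocInstance 2 m) (A : Allocation 2 m) {i j : Fin 2}
    (hij : i ≠ j) :
    I.NoEnvyUpToOne A i j ↔
      0 ≤ ∑ q, I.gap A i q ∨ ∃ q, I.gap A i q ≤ ∑ q, I.gap A i q := by
  rw [I.sum_gap A hij]
  constructor
  · rintro ⟨X, Y, hX, hY, hc, h⟩
    rw [I.value_sdiff i hX, I.value_sdiff i hY] at h
    rcases (X ∪ Y).eq_empty_or_nonempty with he | ⟨q, hq⟩
    · obtain ⟨rfl, rfl⟩ := Finset.union_eq_empty.1 he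
      left
      simp [value] at h ⊢
      linarith
    · right
      have hs : X ∪ Y = {q} := by
        refine Finset.eq_singleton_iff_unique_mem.2 ⟨hq, fun x hx => ?_⟩
        exact Finset.card_le_one.1 hc x hx q hq
      have hXs : X = ∅ ∨ X = {q} := Finset.subset_singleton_iff.1 (hs ▸ Finset.subset_union_left)
      have hYs : Y = ∅ ∨ Y = {q} := Finset.subset_singleton_iff.1 (hs ▸ Finset.subset_union_right)
      refine ⟨q, ?_⟩
      rcases hXs with rfl | rfl <;> rcases hYs with rfl | rfl <;>
        simp_all [value, bundle, gap]
      · split_ifs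
        · omega
        · linarith
      · linarith
  · rintro (h | ⟨q, h⟩)
    · refine ⟨∅, ∅, by simp, by simp, by simp, ?_⟩
      simpa using h
    · by_cases hq : A q = i
      · have hX : {q} ⊆ bundle A i := by simpa [bundle] using hq
        refine ⟨{q}, ∅, hX, by simp, by simp, ?_⟩
        rw [I.value_sdiff i hX]
        simp [gap, hq, value] at h ⊢
        linarith
      · have hY : {q} ⊆ bundle A j := by simp [bundle]; omega
        refine ⟨∅, {q}, by simp, hY, by simp, ?_⟩
        rw [I.value_sdiff i hY]
        simp [gap, hq, value] at h ⊢
        linarith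

theorem pref_self {n : ℕ} (I : AllocInstance n m) (p : Fin m) (i : Fin n) : I.pref p i i := by
  simpa using I.pref_total p i i

theorem ratio_pos (I : AllocInstance 2 m) {p : Fin m} (h : I.IsPos p ∨ I.IsNeg p) :
    0 < I.ratio p := by
  rcases h with h | h
  · exact div_pos (abs_pos.2 h.1.ne') (abs_pos.2 h.2.ne')
  · exact div_pos (abs_pos.2 h.1.ne) (abs_pos.2 h.2.ne)

theorem ratio_mul (I : AllocInstance 2 m) {p : Fin m}
    (h : I.IsPos p ∨ I.IsNeg p) : I.v 0 p = I.ratio p * I.v 1 p := by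
  rcases h with h | h
  · rw [ratio, abs_of_pos h.1, abs_of_pos h.2, div_mul_cancel₀ _ h.2.ne']
  · rw [ratio, abs_of_neg h.1, abs_of_neg h.2, neg_div_neg_eq, div_mul_cancel₀ _ h.2.ne]

/-- A player who changes team takes her value from the old team and brings her value to the new one;
the weighted loss is her weighted gap in `A`. -/
theorem weight_sub (I : AllocInstance 2 m) (t : ℝ) (A A' : Allocation 2 m) :
    (I.value 0 (bundle A 0) + t * I.value 1 (bundle A 1)) -
      (I.value 0 (bundle A' 0) + t * I.value 1 (bundle A' 1)) =
      ∑ p, if A' p = A p then 0 else I.gap A 0 p + t * I.gap A 1 p := by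
  simp only [value_bundle_eq_sum, Finset.mul_sum]
  rw [← Finset.sum_add_distrib, ← Finset.sum_add_distrib, ← Finset.sum_sub_distrib]
  refine Finset.sum_congr rfl fun p _ => ?_
  rcases Fin.exists_fin_two.1 ⟨A p, rfl⟩ with e | e <;>
    rcases Fin.exists_fin_two.1 ⟨A' p, rfl⟩ with e' | e' <;> simp [gap, e, e'] <;> ring

/-- Whether a player leaves or joins team `i`, its value drops by exactly her gap. -/
theorem value_lt_of_change (I : AllocInstance 2 m) (i : Fin 2) {A A' : Allocation 2 m} {q : Fin m}
    (hq : A' q ≠ A q) (hq' : 0 < I.gap A i q)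
    (hc : ∀ p, A' p ≠ A p → 0 ≤ I.gap A i p) :
    I.value i (bundle A' i) < I.value i (bundle A i) := by
  have key : ∀ p, (if A p = i then I.v i p else 0) - (if A' p = i then I.v i p else 0) =
      if A' p = A p then 0 else I.gap A i p := by
    intro p
    by_cases e : A' p = A p
    · simp [e]
    · by_cases e1 : A p = i
      · have : A' p ≠ i := fun e2 => e (e2.trans e1.symm)
        simp [gap, e1, this]
      · have : A' p = i := by omega
        subst this
        simp [gap, e1, Ne.symm e1]
  rw [value_bundle_eq_sum, value_bundle_eq_sum]
  refine Finset.sum_lt_sum (fun p _ => ?_) ⟨q, Finset.mem_univ q, ?_⟩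
  · have := key p
    by_cases e : A' p = A p
    · rw [if_pos e] at this
      linarith
    · rw [if_neg e] at this
      linarith [hc p e]
  · have := key q
    rw [if_neg hq] at this
    linarith

theorem trichotomy (I : AllocInstance 2 m) (p : Fin m) :
    I.IsPos p ∨ I.IsNeg p ∨ I.IsZero p ∨ I.IsStarOne p ∨ I.IsStarTwo p := by
  by_cases hz : I.IsZero p
  · exact Or.inr (Or.inr (Or.inl hz))
  simp only [IsPos, IsNeg, IsStarOne, IsStarTwo, hz, not_false_eq_true, true_and, false_or]
  rcases lt_trichotomy (I.v 0 p) 0 with h | h | h <;>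
    rcases lt_trichotomy (I.v 1 p) 0 with h' | h' | h' <;> simp [h, h', h.le, h'.le]

theorem IsPos.not_isNeg {I : AllocInstance 2 m} {p : Fin m} (h : I.IsPos p) : ¬ I.IsNeg p :=
  fun h' => lt_asymm h.1 h'.1

/-! ### The loop: moved players and players not moved. -/

/-- The positive players of `l` are moved to team 2 and the other players of `l` to team 1. -/
def IsMoved (I : AllocInstance 2 m) (A₀ : Allocation 2 m) (l : List (Fin m))
    (A : Allocation 2 m) : Prop :=
  ∀ q, (q ∉ l → A q = A₀ q) ∧ (q ∈ l → I.IsPos q → A q = 1) ∧ (q ∈ l → ¬ I.IsPos q → A q = 0)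

theorem isMoved_nil (I : AllocInstance 2 m) (A : Allocation 2 m) : I.IsMoved A [] A := by
  intro q; simp

-- If `p` occurs again in `l`, both moves send her to the same team, so distinctness is not needed.
open Classical in
theorem IsMoved.cons {I : AllocInstance 2 m} {A₀ A : Allocation 2 m} {l : List (Fin m)} {p : Fin m}
    (h : I.IsMoved (Function.update A₀ p (if I.IsPos p then 1 else 0)) l A) :
    I.IsMoved A₀ (p :: l) A := by
  intro q
  obtain ⟨h1, h2, h3⟩ := h q
  by_cases hl : q ∈ l
  · simp_all
  · by_cases hp : q = p
    · subst hp
      simp_all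
    · simp_all

/-- The players of the list that are moved by the loop form a prefix of the list, and the loop runs
as long as team 2 envies team 1 by more than one player. -/
theorem gawLoop_split (I : AllocInstance 2 m) (l : List (Fin m)) (A₀ : Allocation 2 m) :
    ∃ l₁ l₂, l = l₁ ++ l₂ ∧ I.IsMoved A₀ l₁ (I.gawLoop l A₀) ∧
      (l₂ = [] ∨ I.NoEnvyUpToOne (I.gawLoop l A₀) 1 0) ∧
      (l₁ = [] ∨ ∃ l' p B, l₁ = l' ++ [p] ∧ (∀ q, q ≠ p → I.gawLoop l A₀ q = B q) ∧
        ¬ I.NoEnvyUpToOne B 1 0) := by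
  classical
  induction l generalizing A₀ with
  | nil => exact ⟨[], [], rfl, I.isMoved_nil _, Or.inl rfl, Or.inl rfl⟩
  | cons p l ih =>
    by_cases h : I.NoEnvyUpToOne A₀ 1 0
    · refine ⟨[], p :: l, rfl, ?_, ?_, Or.inl rfl⟩
      · simp [gawLoop, h, isMoved_nil]
      · simp [gawLoop, h]
    · have e : I.gawLoop (p :: l) A₀
          = I.gawLoop l (Function.update A₀ p (if I.IsPos p then 1 else 0)) := by
        simp [gawLoop, h]
      rw [e]
      obtain ⟨l₁, l₂, hl, hm, h2, h1⟩ := ih (Function.update A₀ p (if I.IsPos p then 1 else 0))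
      refine ⟨p :: l₁, l₂, by simp [hl], hm.cons, h2, Or.inr ?_⟩
      rcases h1 with rfl | ⟨l', p', B, hl', hB, hE⟩
      -- No move follows: the move of `p` is the last one, and `A₀` is the allocation just before
      -- it.
      · refine ⟨[], p, A₀, rfl, fun q hq => ?_, h⟩
        rw [(hm q).1 (by simp), Function.update_of_ne hq]
      · exact ⟨p :: l', p', B, by simp [hl'], hB, hE⟩

/-- The moved players `l₁` and the players `l₂` that have not been moved, in an output of the
procedure. -/
structure IsSplit (I : AllocInstance 2 m) (A₀ : Allocation 2 m) (l₁ l₂ : List (Fin m))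
    (A : Allocation 2 m) : Prop where
  order : I.IsGAWOrder (l₁ ++ l₂)
  start : I.IsGAWStart A₀
  moved : I.IsMoved A₀ l₁ A

namespace IsSplit

variable {I : AllocInstance 2 m} {A₀ A : Allocation 2 m} {l₁ l₂ : List (Fin m)}

theorem lex (h : I.IsSplit A₀ l₁ l₂ A) {p q : Fin m} (hp : p ∈ l₁) (hq : q ∈ l₂) :
    I.ratio p < I.ratio q ∨ (I.ratio p = I.ratio q ∧ I.tieClass p ≤ I.tieClass q) :=
  (List.pairwise_append.1 h.order.2.2).2.2 p hp q hq

theorem mem_iff (h : I.IsSplit A₀ l₁ l₂ A) (p : Fin m) :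
    p ∈ l₁ ∨ p ∈ l₂ ↔ I.IsPos p ∨ I.IsNeg p := by
  rw [← h.order.2.1, List.mem_append]

theorem not_mem_left (h : I.IsSplit A₀ l₁ l₂ A) {p : Fin m} (hp : p ∈ l₂) : p ∉ l₁ :=
  fun hp' => (List.nodup_append.1 h.order.1).2.2 p hp' p hp rfl

theorem eq_of_mem_right (h : I.IsSplit A₀ l₁ l₂ A) {p : Fin m} (hp : p ∈ l₂) : A p = A₀ p :=
  (h.moved p).1 (h.not_mem_left hp)

theorem apply_left_pos (h : I.IsSplit A₀ l₁ l₂ A) {p : Fin m} (hp : p ∈ l₁) (hs : I.IsPos p) :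
    A p = 1 := (h.moved p).2.1 hp hs

theorem apply_left_neg (h : I.IsSplit A₀ l₁ l₂ A) {p : Fin m} (hp : p ∈ l₁) (hs : I.IsNeg p) :
    A p = 0 := (h.moved p).2.2 hp fun h' => h'.not_isNeg hs

theorem apply_right_pos (h : I.IsSplit A₀ l₁ l₂ A) {p : Fin m} (hp : p ∈ l₂) (hs : I.IsPos p) :
    A p = 0 := (h.eq_of_mem_right hp).trans ((h.start p).2.1 (Or.inl hs))

theorem apply_right_neg (h : I.IsSplit A₀ l₁ l₂ A) {p : Fin m} (hp : p ∈ l₂) (hs : I.IsNeg p) :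
    A p = 1 := (h.eq_of_mem_right hp).trans ((h.start p).2.2 (Or.inl hs))

theorem apply_of_not (h : I.IsSplit A₀ l₁ l₂ A) {p : Fin m} (hp : ¬ (I.IsPos p ∨ I.IsNeg p)) :
    A p = A₀ p :=
  (h.moved p).1 fun h' => hp ((h.mem_iff p).1 (Or.inl h'))

/-- The sign type of a player and her side of the stopping point determine her team, except for zero
players. The sign computations below run through these seven cases. -/
theorem cases_player (h : I.IsSplit A₀ l₁ l₂ A) (p : Fin m) :
    (p ∈ l₁ ∧ I.IsPos p ∧ A p = 1) ∨ (p ∈ l₁ ∧ I.IsNeg p ∧ A p = 0) ∨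
    (p ∈ l₂ ∧ I.IsPos p ∧ A p = 0) ∨ (p ∈ l₂ ∧ I.IsNeg p ∧ A p = 1) ∨
    (I.IsZero p ∧ ∀ i, I.pref p (A p) i) ∨ (I.IsStarOne p ∧ A p = 0) ∨
    (I.IsStarTwo p ∧ A p = 1) := by
  by_cases hp : I.IsPos p ∨ I.IsNeg p
  · rcases (h.mem_iff p).2 hp with hl | hl <;> rcases hp with hs | hs
    · exact Or.inl ⟨hl, hs, h.apply_left_pos hl hs⟩
    · exact Or.inr (Or.inl ⟨hl, hs, h.apply_left_neg hl hs⟩)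
    · exact Or.inr (Or.inr (Or.inl ⟨hl, hs, h.apply_right_pos hl hs⟩))
    · exact Or.inr (Or.inr (Or.inr (Or.inl ⟨hl, hs, h.apply_right_neg hl hs⟩)))
  · have e := h.apply_of_not hp
    obtain ⟨s1, s2, s3⟩ := h.start p
    rw [← e] at s1 s2 s3
    rcases I.trichotomy p with h' | h' | h' | h' | h'
    · exact absurd (Or.inl h') hp
    · exact absurd (Or.inr h') hp
    · simp [h', s1 h']
    · simp [h', s2 (Or.inr h')]
    · simp [h', s3 (Or.inr h')]

/-! ### Weighted optimality, envy and Pareto optimality of an output. -/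

/-- There is a positive number between the ratios of the moved players and those of the others. -/
theorem exists_threshold (h : I.IsSplit A₀ l₁ l₂ A) :
    ∃ t : ℝ, 0 < t ∧ (∀ p ∈ l₁, I.ratio p ≤ t) ∧ ∀ p ∈ l₂, t ≤ I.ratio p := by
  have hpos : ∀ p, p ∈ l₁ ∨ p ∈ l₂ → 0 < I.ratio p :=
    fun p hp => I.ratio_pos ((h.mem_iff p).1 hp)
  -- The threshold is the ratio of the last moved player, or of the first listed player if none was
  -- moved, or `1` if the list is empty.
  rcases l₁.eq_nil_or_concat' with rfl | ⟨l', p, rfl⟩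
  · rcases l₂ with _ | ⟨p, l⟩
    · exact ⟨1, one_pos, by simp, by simp⟩
    · refine ⟨I.ratio p, hpos p (by simp), by simp, fun q hq => ?_⟩
      rcases List.mem_cons.1 hq with rfl | hq
      · exact le_rfl
      · rcases (List.pairwise_cons.1 h.order.2.2).1 q hq with h' | h'
        · exact h'.le
        · exact h'.1.le
  · refine ⟨I.ratio p, hpos p (by simp), fun q hq => ?_, fun q hq => ?_⟩
    · rcases List.mem_append.1 hq with hq | hq
      · have := (List.pairwise_append.1 (List.pairwise_append.1 h.order.2.2).1).2.2 q hq p (by simp)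
        rcases this with h' | h'
        · exact h'.le
        · exact h'.1.le
      · rw [List.mem_singleton.1 hq]
    · rcases h.lex (p := p) (by simp) hq with h' | h'
      · exact h'.le
      · exact h'.1.le

/-- With the weights `1` and `t` for the teams, every player is in a team that values her most. -/
theorem gap_nonneg (h : I.IsSplit A₀ l₁ l₂ A) {t : ℝ} (ht : 0 < t)
    (h1 : ∀ p ∈ l₁, I.ratio p ≤ t) (h2 : ∀ p ∈ l₂, t ≤ I.ratio p) (p : Fin m) :
    0 ≤ I.gap A 0 p + t * I.gap A 1 p := by
  rcases h.cases_player p with ⟨hl, hs, e⟩ | ⟨hl, hs, e⟩ | ⟨hl, hs, e⟩ | ⟨hl, hs, e⟩ | ⟨hs, -⟩ |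
    ⟨hs, e⟩ | ⟨hs, e⟩
  · have := h1 p hl
    have r := I.ratio_mul (Or.inl hs)
    simp [gap, e]
    nlinarith [hs.2]
  · have := h1 p hl
    have r := I.ratio_mul (Or.inr hs)
    simp [gap, e]
    nlinarith [hs.2]
  · have := h2 p hl
    have r := I.ratio_mul (Or.inl hs)
    simp [gap, e]
    nlinarith [hs.2]
  · have := h2 p hl
    have r := I.ratio_mul (Or.inr hs)
    simp [gap, e]
    nlinarith [hs.2]
  · simp [gap, hs.1, hs.2]
  · simp [gap, e]
    nlinarith [hs.2.1, hs.2.2]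
  · simp [gap, e]
    nlinarith [hs.2.1, hs.2.2]

/-- For a player valued with the same strict sign by both teams, the weighted gap is `±(t - ratio)`
times her value for team 2. For a player of `P_1^*` or `P_2^*` it is `|v₁| + t|v₂|`, which is
positive. -/
theorem gap_eq_zero (h : I.IsSplit A₀ l₁ l₂ A) {t : ℝ} (ht : 0 < t) {p : Fin m}
    (h0 : I.gap A 0 p + t * I.gap A 1 p = 0) :
    (I.IsZero p ∧ ∀ i, I.pref p (A p) i) ∨ ((I.IsPos p ∨ I.IsNeg p) ∧ I.ratio p = t) := by
  rcases h.cases_player p with ⟨hl, hs, e⟩ | ⟨hl, hs, e⟩ | ⟨hl, hs, e⟩ | ⟨hl, hs, e⟩ | hs |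
    ⟨hs, e⟩ | ⟨hs, e⟩
  · refine Or.inr ⟨Or.inl hs, mul_right_cancel₀ hs.2.ne' ?_⟩
    rw [← I.ratio_mul (Or.inl hs)]
    simp [gap, e] at h0
    linarith
  · refine Or.inr ⟨Or.inr hs, mul_right_cancel₀ hs.2.ne ?_⟩
    rw [← I.ratio_mul (Or.inr hs)]
    simp [gap, e] at h0
    linarith
  · refine Or.inr ⟨Or.inl hs, mul_right_cancel₀ hs.2.ne' ?_⟩
    rw [← I.ratio_mul (Or.inl hs)]
    simp [gap, e] at h0
    linarith
  · refine Or.inr ⟨Or.inr hs, mul_right_cancel₀ hs.2.ne ?_⟩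
    rw [← I.ratio_mul (Or.inr hs)]
    simp [gap, e] at h0
    linarith
  · exact Or.inl hs
  · refine absurd ?_ hs.1
    simp [gap, e] at h0
    have : I.v 1 p = 0 := by nlinarith [hs.2.1, hs.2.2]
    exact ⟨by rw [this] at h0; linarith, this⟩
  · refine absurd ?_ hs.1
    simp [gap, e] at h0
    have : I.v 1 p = 0 := by nlinarith [hs.2.1, hs.2.2]
    exact ⟨by rw [this] at h0; linarith, this⟩

/-- Once the whole list has been moved, every gap of team 2 is nonnegative. Symmetrically, before
any move every gap of team 1 is nonnegative, which is `noEnvy_zero`. -/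
theorem noEnvy_one (h : I.IsSplit A₀ l₁ [] A) : I.NoEnvyUpToOne A 1 0 := by
  rw [I.noEnvyUpToOne_iff A (by decide)]
  refine Or.inl (Finset.sum_nonneg fun p _ => ?_)
  rcases h.cases_player p with ⟨hl, hs, e⟩ | ⟨hl, hs, e⟩ | ⟨hl, hs, e⟩ | ⟨hl, hs, e⟩ | ⟨hs, -⟩ |
    ⟨hs, e⟩ | ⟨hs, e⟩
  · simpa [gap, e] using hs.2.le
  · simpa [gap, e] using hs.2.le
  · simp at hl
  · simp at hl
  · simp [gap, hs.2]
  · simpa [gap, e] using hs.2.2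
  · simpa [gap, e] using hs.2.2

theorem noEnvy_zero (h : I.IsSplit A₀ [] l₂ A) : I.NoEnvyUpToOne A 0 1 := by
  rw [I.noEnvyUpToOne_iff A (by decide)]
  refine Or.inl (Finset.sum_nonneg fun p _ => ?_)
  rcases h.cases_player p with ⟨hl, hs, e⟩ | ⟨hl, hs, e⟩ | ⟨hl, hs, e⟩ | ⟨hl, hs, e⟩ | ⟨hs, -⟩ |
    ⟨hs, e⟩ | ⟨hs, e⟩
  · simp at hl
  · simp at hl
  · simpa [gap, e] using hs.1.le
  · simpa [gap, e] using hs.1.le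
  · simp [gap, hs.1]
  · simpa [gap, e] using hs.2.1
  · simpa [gap, e] using hs.2.1

/-- If team 2 envied team 1 by more than one player before the last move, then after this move
team 1 does not envy team 2 by more than one player. -/
theorem noEnvy_zero_of_envy (h : I.IsSplit A₀ l₁ l₂ A) {B : Allocation 2 m} {p : Fin m}
    (hB : ∀ q, q ≠ p → A q = B q) (hE : ¬ I.NoEnvyUpToOne B 1 0) : I.NoEnvyUpToOne A 0 1 := by
  obtain ⟨t, ht, h1, h2⟩ := h.exists_threshold
  rw [I.noEnvyUpToOne_iff B (by decide), not_or, not_exists] at hE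
  have hp := hE.2 p
  rw [I.noEnvyUpToOne_iff A (by decide)]
  refine Or.inr ⟨p, ?_⟩
  -- Envy in `B` makes the sum of the gaps of team 2 over the players other than `p` negative, and
  -- these gaps are the same in `A`.
  rw [← Finset.add_sum_erase _ _ (Finset.mem_univ p)] at hp ⊢
  have e : ∑ q ∈ Finset.univ.erase p, I.gap B 1 q = ∑ q ∈ Finset.univ.erase p, I.gap A 1 q :=
    Finset.sum_congr rfl fun q hq => by simp only [gap, hB q (Finset.ne_of_mem_erase hq)]
  -- In `A` the weighted gaps of the players other than `p` have a nonnegative sum; as the part of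
  -- team 2 is negative, that of team 1 is positive.
  have := Finset.sum_nonneg fun q (_ : q ∈ Finset.univ.erase p) => h.gap_nonneg ht h1 h2 q
  rw [Finset.sum_add_distrib, ← Finset.mul_sum] at this
  rw [e] at hp
  nlinarith

/-- `A` maximises the weighted sum, so an `A'` that is no worse for either team attains the same
maximum. Since `t > 0`, neither team gains, and the nonnegative weighted gaps of the reassigned
players add up to zero. -/
theorem changed_gap (h : I.IsSplit A₀ l₁ l₂ A) {t : ℝ} (ht : 0 < t)
    (h1 : ∀ p ∈ l₁, I.ratio p ≤ t) (h2 : ∀ p ∈ l₂, t ≤ I.ratio p) {A' : Allocation 2 m}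
    (hA : ∀ i, I.value i (bundle A i) ≤ I.value i (bundle A' i)) :
    (∀ i, I.value i (bundle A i) = I.value i (bundle A' i)) ∧
    ∀ p, A' p ≠ A p → I.gap A 0 p + t * I.gap A 1 p = 0 := by
  have w := weight_sub I t A A'
  have hn : ∀ p ∈ Finset.univ,
      0 ≤ if A' p = A p then 0 else I.gap A 0 p + t * I.gap A 1 p := fun p _ => by
    split_ifs
    · exact le_rfl
    · exact h.gap_nonneg ht h1 h2 p
  have hs := Finset.sum_nonneg hn
  have a0 := hA 0
  have a1 := hA 1
  have a1' := mul_le_mul_of_nonneg_left a1 ht.le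
  refine ⟨?_, fun p hp => ?_⟩
  · rw [Fin.forall_fin_two]
    refine ⟨by linarith, mul_left_cancel₀ ht.ne' (by linarith)⟩
  · have := (Finset.sum_eq_zero_iff_of_nonneg hn).1 (by linarith) p (Finset.mem_univ p)
    simpa [hp] using this

theorem teamPO (h : I.IsSplit A₀ l₁ l₂ A) : I.TeamPO A := by
  rintro A' ⟨hA, i, hi⟩
  obtain ⟨t, ht, h1, h2⟩ := h.exists_threshold
  exact hi.ne ((h.changed_gap ht h1 h2 hA).1 i)

theorem po (h : I.IsSplit A₀ l₁ l₂ A) : I.PO A := by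
  rintro A' ⟨hA, hP, hS⟩
  obtain ⟨t, ht, h1, h2⟩ := h.exists_threshold
  obtain ⟨hv, hg⟩ := h.changed_gap ht h1 h2 hA
  rcases hS with ⟨i, hi⟩ | ⟨q, hq⟩
  · exact hi.ne (hv i)
  have hne : A' q ≠ A q := fun e => hq.2 (e ▸ I.pref_self q _)
  have two : ∀ {p}, A' p ≠ A p → (A p = 0 → A' p = 1) ∧ (A p = 1 → A' p = 0) := by
    intro p hp; omega
  -- Reassigned players of the list are not zero players, so their ratio is `t`; only the tie class
  -- orders them.
  have tie : ∀ p ∈ l₁, ∀ q ∈ l₂, A' p ≠ A p → A' q ≠ A q → I.tieClass p ≤ I.tieClass q := by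
    intro p hp q hq' hp1 hq1
    have rp : I.ratio p = t := by
      rcases h.gap_eq_zero ht (hg p hp1) with h' | h'
      · rcases (h.mem_iff p).1 (Or.inl hp) with k | k
        · exact absurd h'.1.1 k.1.ne'
        · exact absurd h'.1.1 k.1.ne
      · exact h'.2
    have rq : I.ratio q = t := by
      rcases h.gap_eq_zero ht (hg q hq1) with h' | h'
      · rcases (h.mem_iff q).1 (Or.inr hq') with k | k
        · exact absurd h'.1.1 k.1.ne'
        · exact absurd h'.1.1 k.1.ne
      · exact h'.2
    rcases h.lex hp hq' with h' | h'
    · exact absurd h' (by rw [rp, rq]; exact lt_irrefl _)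
    · exact h'.2
  -- A moved player of class 1 strictly prefers her team in `A` and would be worse off in `A'`.
  have t1 : ∀ p ∈ l₁, A' p ≠ A p → I.tieClass p ≠ 1 := by
    intro p hp hp1 hc
    have hpr := hP p
    rcases (h.mem_iff p).1 (Or.inl hp) with k | k
    · have e := h.apply_left_pos hp k
      have e' := (two hp1).2 e
      rw [e, e'] at hpr
      have : ¬ I.strictPref p 1 0 := fun hh => hh.2 hpr
      simp [tieClass, k.not_isNeg, this] at hc
      split_ifs at hc <;> omega
    · have e := h.apply_left_neg hp k
      have e' := (two hp1).1 e
      rw [e, e'] at hpr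
      have : ¬ I.strictPref p 0 1 := fun hh => hh.2 hpr
      have k' : ¬ I.IsPos p := fun k' => k'.not_isNeg k
      simp [tieClass, k', this] at hc
      split_ifs at hc <;> omega
  -- A player not yet moved who accepts the other team either is indifferent or strictly prefers
  -- that team, which is class 2 or class 1.
  have t2 : ∀ p ∈ l₂, A' p ≠ A p → I.tieClass p ≤ 2 := by
    intro p hp hp1
    have hpr := hP p
    rcases (h.mem_iff p).1 (Or.inr hp) with k | k
    · have e := h.apply_right_pos hp k
      have e' := (two hp1).1 e
      rw [e, e'] at hpr
      by_cases hh : I.pref p 0 1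
      · have : I.indiff p 0 1 := ⟨hh, hpr⟩
        simp only [tieClass, this, if_true]
        split_ifs <;> omega
      · have : I.strictPref p 1 0 := ⟨hpr, hh⟩
        simp [tieClass, k, this]
    · have e := h.apply_right_neg hp k
      have e' := (two hp1).2 e
      rw [e, e'] at hpr
      by_cases hh : I.pref p 1 0
      · have : I.indiff p 0 1 := ⟨hpr, hh⟩
        simp only [tieClass, this, if_true]
        split_ifs <;> omega
      · have : I.strictPref p 0 1 := ⟨hpr, hh⟩
        simp [tieClass, k, this]
  -- The player `q` who gains strictly prefers the team that she is not in: this is class 3 if she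
  -- was moved and class 1 if she was not.
  have s1 : q ∈ l₁ → I.tieClass q = 3 := by
    intro hl
    rcases (h.mem_iff q).1 (Or.inl hl) with k | k
    · have e := h.apply_left_pos hl k
      have e' := (two hne).2 e
      rw [e, e'] at hq
      simp [tieClass, k.not_isNeg, strictPref, indiff, hq.1, hq.2]
    · have e := h.apply_left_neg hl k
      have e' := (two hne).1 e
      rw [e, e'] at hq
      have k' : ¬ I.IsPos q := fun k' => k'.not_isNeg k
      simp [tieClass, k', strictPref, indiff, hq.1, hq.2]
  have s2 : q ∈ l₂ → I.tieClass q = 1 := by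
    intro hl
    rcases (h.mem_iff q).1 (Or.inr hl) with k | k
    · have e := h.apply_right_pos hl k
      have e' := (two hne).1 e
      rw [e, e'] at hq
      simp [tieClass, k, hq]
    · have e := h.apply_right_neg hl k
      have e' := (two hne).2 e
      rw [e, e'] at hq
      simp [tieClass, k, hq]
  have g1 : ∀ p ∈ l₁, 0 < I.gap A 1 p := by
    intro p hp
    rcases (h.mem_iff p).1 (Or.inl hp) with k | k
    · simpa [gap, h.apply_left_pos hp k] using k.2
    · simpa [gap, h.apply_left_neg hp k] using k.2
  have g0 : ∀ p ∈ l₂, 0 < I.gap A 0 p := by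
    intro p hp
    rcases (h.mem_iff p).1 (Or.inr hp) with k | k
    · simpa [gap, h.apply_right_pos hp k] using k.1
    · simpa [gap, h.apply_right_neg hp k] using k.1
  rcases h.gap_eq_zero ht (hg q hne) with hz | ⟨hpn, -⟩
  · exact hq.2 (hz.2 _)
  rcases (h.mem_iff q).2 hpn with hl | hl
  -- If `q` was moved, her class 3 exceeds the class of any reassigned player after the stopping
  -- point, so no such player exists. All changes then cost team 2, and that of `q` does so
  -- strictly.
  · refine (value_lt_of_change I 1 hne (g1 q hl) fun p hp => ?_).ne' (hv 1)
    rcases h.gap_eq_zero ht (hg p hp) with hz | ⟨hpn', -⟩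
    · simp [gap, hz.1.2]
    · rcases (h.mem_iff p).2 hpn' with hp' | hp'
      · exact (g1 p hp').le
      · have := tie q hl p hp' hne hp
        have := t2 p hp' hp
        have := s1 hl
        omega
  -- If `q` was not moved, she has class 1, so a reassigned moved player would need class 1 as well,
  -- against `t1`. Here team 1 loses.
  · refine (value_lt_of_change I 0 hne (g0 q hl) fun p hp => ?_).ne' (hv 0)
    rcases h.gap_eq_zero ht (hg p hp) with hz | ⟨hpn', -⟩
    · simp [gap, hz.1.1]
    · rcases (h.mem_iff p).2 hpn' with hp' | hp'
      · have a := tie p hp' q hl hp hne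
        have b := t1 p hp' hp
        rw [s2 hl] at a
        have : 1 ≤ I.tieClass p := by
          simp only [tieClass]
          split_ifs <;> omega
        omega
      · exact (g0 p hp').le

end IsSplit

/-- Every output of the procedure is EF1, PO and team-PO. -/
theorem IsGAWOutput.fair {I : AllocInstance 2 m} {A : Allocation 2 m} (h : I.IsGAWOutput A) :
    I.EF1 A ∧ I.PO A ∧ I.TeamPO A := by
  obtain ⟨l, A₀, ho, hs, rfl⟩ := h
  obtain ⟨l₁, l₂, rfl, hm, h2, h1⟩ := I.gawLoop_split l A₀
  have hsp : I.IsSplit A₀ l₁ l₂ (I.gawLoop (l₁ ++ l₂) A₀) := ⟨ho, hs, hm⟩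
  refine ⟨?_, hsp.po, hsp.teamPO⟩
  have e1 : I.NoEnvyUpToOne (I.gawLoop (l₁ ++ l₂) A₀) 1 0 := by
    rcases h2 with rfl | h2
    · exact hsp.noEnvy_one
    · exact h2
  have e0 : I.NoEnvyUpToOne (I.gawLoop (l₁ ++ l₂) A₀) 0 1 := by
    rcases h1 with rfl | ⟨l', p, B, -, hB, hE⟩
    · exact hsp.noEnvy_zero
    · exact hsp.noEnvy_zero_of_envy hB hE
  intro i j hij
  rcases Fin.exists_fin_two.1 ⟨i, rfl⟩ with rfl | rfl <;>
    rcases Fin.exists_fin_two.1 ⟨j, rfl⟩ with rfl | rfl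
  · exact absurd rfl hij
  · exact e0
  · exact e1
  · exact absurd rfl hij

end AllocInstance

/-! ## Reasoning about programs -/

theorem Memory.setNat_nat (s : Memory) (x k a y i : ℕ) :
    (s.setNat x k a).nat y i = if y = x ∧ i = k then a else s.nat y i := by
  by_cases hy : y = x
  · subst hy
    by_cases hi : i = k <;> simp [Memory.setNat, hi]
  · simp [Memory.setNat, hy]

theorem Memory.setReal_real (s : Memory) (x k : ℕ) (a : ℝ) (y i : ℕ) :
    (s.setReal x k a).real y i = if y = x ∧ i = k then a else s.real y i := by
  by_cases hy : y = x
  · subst hy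
    by_cases hi : i = k <;> simp [Memory.setReal, hi]
  · simp [Memory.setReal, hy]

theorem Memory.setReal_nat (s : Memory) (x k : ℕ) (a : ℝ) : (s.setReal x k a).nat = s.nat := rfl

namespace Program

/-- The weakest precondition of a program without loops. -/
def wp : Program → (Memory → Prop) → Memory → Prop
  | skip, Q, s => Q s
  | natStore x i e, Q, s => Q (s.setNat x (i.eval s) (e.eval s))
  | realStore x i e, Q, s => Q (s.setReal x (i.eval s) (e.eval s))
  | seq c d, Q, s => c.wp (d.wp Q) s
  | branch t c d, Q, s => (t.eval s → c.wp Q s) ∧ (¬ t.eval s → d.wp Q s)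
  | whileDo _ _, _, _ => False

/-- A bound for the number of steps of a program without loops. -/
def bound : Program → ℕ
  | skip => 1
  | natStore _ i e => i.cost + e.cost + 1
  | realStore _ i e => i.cost + e.cost + 1
  | seq c d => c.bound + d.bound
  | branch t c d => t.cost + max c.bound d.bound + 1
  | whileDo _ _ => 0

/-- Started in `s`, the program halts within `K` steps in a memory that satisfies `Q`. -/
def Halts (c : Program) (s : Memory) (K : ℕ) (Q : Memory → Prop) : Prop :=
  ∃ k s', k ≤ K ∧ Exec c s k s' ∧ Q s'

/-- Loops have the precondition `False`, so their dummy bound `0` is never used. -/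
theorem wp.halts {c : Program} {Q : Memory → Prop} {s : Memory} (h : c.wp Q s) :
    c.Halts s c.bound Q := by
  induction c generalizing Q s with
  | skip => exact ⟨_, _, le_rfl, Exec.skip s, h⟩
  | natStore x i e => exact ⟨_, _, le_rfl, Exec.natStore x i e s, h⟩
  | realStore x i e => exact ⟨_, _, le_rfl, Exec.realStore x i e s, h⟩
  | seq c d ihc ihd =>
    obtain ⟨k, s', hk, hc, h'⟩ := ihc h
    obtain ⟨l, s'', hl, hd, hQ⟩ := ihd h'
    exact ⟨_, _, Nat.add_le_add hk hl, Exec.seq hc hd, hQ⟩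
  | branch t c d ihc ihd =>
    by_cases ht : t.eval s
    · obtain ⟨k, s', hk, hc, hQ⟩ := ihc (h.1 ht)
      exact ⟨_, _, by simp only [bound]; omega, Exec.branchTrue d ht hc, hQ⟩
    · obtain ⟨k, s', hk, hc, hQ⟩ := ihd (h.2 ht)
      exact ⟨_, _, by simp only [bound]; omega, Exec.branchFalse c ht hc, hQ⟩
  | whileDo t c => exact h.elim

theorem Halts.mono {c : Program} {s : Memory} {K L : ℕ} {Q R : Memory → Prop} (h : c.Halts s K Q)
    (hKL : K ≤ L) (hQR : ∀ s', Q s' → R s') : c.Halts s L R := by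
  obtain ⟨k, s', hk, he, hQ⟩ := h
  exact ⟨k, s', hk.trans hKL, he, hQR _ hQ⟩

theorem Halts.seq {c d : Program} {s : Memory} {K L : ℕ} {Q R : Memory → Prop}
    (hc : c.Halts s K R) (hd : ∀ s', R s' → d.Halts s' L Q) :
    (Program.seq c d).Halts s (K + L) Q := by
  obtain ⟨k, s', hk, he, hR⟩ := hc
  obtain ⟨l, s'', hl, he', hQ⟩ := hd s' hR
  exact ⟨_, _, Nat.add_le_add hk hl, Exec.seq he he', hQ⟩

/-- The rule for loops, with a variant. -/
theorem Halts.whileDo {t : Test} {c : Program} {K : ℕ} {J : ℕ → Memory → Prop}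
    (hJ : ∀ n s, J n s → t.eval s → c.Halts s K fun s' => ∃ n' < n, J n' s')
    {n : ℕ} {s : Memory} (h : J n s) :
    (Program.whileDo t c).Halts s (n * (K + t.cost + 1) + (t.cost + 1))
      fun s' => (∃ n', J n' s') ∧ ¬ t.eval s' := by
  induction n using Nat.strong_induction_on generalizing s with
  | _ n ih =>
    by_cases ht : t.eval s
    · obtain ⟨k, s', hk, he, n', hn', h'⟩ := hJ n s h ht
      obtain ⟨l, s'', hl, he', hQ⟩ := ih n' hn' h'
      refine ⟨_, _, ?_, Exec.whileTrue ht he he', hQ⟩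
      -- As `n' + 1 ≤ n`, the budget for `n` exceeds that for `n'` by at least one iteration.
      have := Nat.mul_le_mul_right (K + t.cost + 1) (Nat.succ_le_of_lt hn')
      rw [Nat.succ_mul] at this
      omega
    · exact ⟨_, _, Nat.le_add_left _ _, Exec.whileFalse c ht, ⟨n, h⟩, ht⟩

end Program

/-! ## The order of the players -/

namespace AllocInstance

variable {m : ℕ}

/-- The sorting key of the procedure. -/
noncomputable def key (I : AllocInstance 2 m) (p : Fin m) : ℝ ×ₗ ℕ :=
  toLex (I.ratio p, I.tieClass p)

theorem key_le_key (I : AllocInstance 2 m) (p q : Fin m) :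
    I.key p ≤ I.key q ↔
      I.ratio p < I.ratio q ∨ (I.ratio p = I.ratio q ∧ I.tieClass p ≤ I.tieClass q) :=
  Prod.Lex.toLex_le_toLex

/-- The machine has neither division nor absolute values; cross-multiplying and squaring removes
both. -/
theorem ratio_le_ratio (I : AllocInstance 2 m) {p q : Fin m} (hp : I.v 1 p ≠ 0)
    (hq : I.v 1 q ≠ 0) :
    I.ratio p ≤ I.ratio q ↔
      (I.v 0 p * I.v 1 q) * (I.v 0 p * I.v 1 q) ≤ (I.v 0 q * I.v 1 p) * (I.v 0 q * I.v 1 p) := by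
  rw [ratio, ratio, div_le_div_iff₀ (abs_pos.2 hp) (abs_pos.2 hq), ← abs_mul, ← abs_mul,
    abs_le_iff_mul_self_le]

/-- The lexicographic order written with `≤` tests and connectives only, in the form of `keyTest`.
-/
theorem key_le_key_iff (I : AllocInstance 2 m) (p q : Fin m) :
    I.key p ≤ I.key q ↔
      I.ratio p ≤ I.ratio q ∧ ¬ (I.ratio q ≤ I.ratio p ∧ ¬ I.tieClass p ≤ I.tieClass q) := by
  rw [key_le_key]
  rcases lt_trichotomy (I.ratio p) (I.ratio q) with h | h | h
  · simp [h, h.le, h.not_ge]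
  · simp [h]
  · simp [h.not_gt, h.ne', h.not_ge]

/-- `A'` is a possible result of the loop from `A` on, if the players of `S` are still to be
treated. -/
def CanEnd (I : AllocInstance 2 m) (S : Finset (Fin m)) (A A' : Allocation 2 m) : Prop :=
  ∃ l : List (Fin m), l.Nodup ∧ (∀ p, p ∈ l ↔ p ∈ S) ∧
    l.Pairwise (fun p q => I.key p ≤ I.key q) ∧ A' = I.gawLoop l A

theorem CanEnd.isGAWOutput {I : AllocInstance 2 m} {S : Finset (Fin m)} {A A' : Allocation 2 m}
    (h : I.CanEnd S A A') (hS : ∀ p, p ∈ S ↔ I.IsPos p ∨ I.IsNeg p) (hA : I.IsGAWStart A) :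
    I.IsGAWOutput A' := by
  obtain ⟨l, h1, h2, h3, rfl⟩ := h
  refine ⟨l, A, ⟨h1, fun p => (h2 p).trans (hS p), ?_⟩, hA, rfl⟩
  exact h3.imp fun h => (I.key_le_key _ _).1 h

-- This justifies selection: a least remaining player in front of a sorted list of the others gives
-- a sorted list, and the loop moves her since team 2 still envies.
open Classical in
theorem CanEnd.step {I : AllocInstance 2 m} {S : Finset (Fin m)} {A A' : Allocation 2 m}
    {p : Fin m} (hp : p ∈ S) (hmin : ∀ q ∈ S, I.key p ≤ I.key q) (hE : ¬ I.NoEnvyUpToOne A 1 0)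
    (h : I.CanEnd (S.erase p) (Function.update A p (if I.IsPos p then 1 else 0)) A') :
    I.CanEnd S A A' := by
  obtain ⟨l, h1, h2, h3, rfl⟩ := h
  refine ⟨p :: l, ?_, ?_, ?_, ?_⟩
  · exact List.nodup_cons.2 ⟨fun hl => by simpa using (h2 p).1 hl, h1⟩
  · intro q
    rw [List.mem_cons, h2, Finset.mem_erase]
    by_cases e : q = p
    · simp [e, hp]
    · simp [e]
  · exact List.pairwise_cons.2 ⟨fun q hq => hmin q (Finset.mem_of_mem_erase ((h2 q).1 hq)), h3⟩
  · simp [gawLoop, hE]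

theorem exists_sorted (I : AllocInstance 2 m) (S : Finset (Fin m)) :
    ∃ l : List (Fin m), l.Nodup ∧ (∀ p, p ∈ l ↔ p ∈ S) ∧
      l.Pairwise (fun p q => I.key p ≤ I.key q) := by
  induction S using Finset.strongInduction with
  | H S ih =>
    rcases S.eq_empty_or_nonempty with rfl | hne
    · exact ⟨[], by simp, by simp, by simp⟩
    · obtain ⟨p, hp, hmin⟩ := S.exists_min_image I.key hne
      obtain ⟨l, h1, h2, h3⟩ := ih _ (Finset.erase_ssubset hp)
      refine ⟨p :: l, ?_, fun q => ?_, ?_⟩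
      · exact List.nodup_cons.2 ⟨fun hl => by simpa using (h2 p).1 hl, h1⟩
      · rw [List.mem_cons, h2, Finset.mem_erase]
        by_cases e : q = p
        · simp [e, hp]
        · simp [e]
      · exact List.pairwise_cons.2
          ⟨fun q hq => hmin q (Finset.mem_of_mem_erase ((h2 q).1 hq)), h3⟩

/-- An output refers to a list of all players with equal strict signs, even if the loop stops early.
The remaining players can be listed in any sorted order, since the loop no longer looks at them. -/
theorem canEnd_self (I : AllocInstance 2 m) (S : Finset (Fin m)) (A : Allocation 2 m)
    (h : S = ∅ ∨ I.NoEnvyUpToOne A 1 0) : I.CanEnd S A A := by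
  obtain ⟨l, h1, h2, h3⟩ := I.exists_sorted S
  refine ⟨l, h1, h2, h3, ?_⟩
  rcases l with _ | ⟨p, l⟩
  · rfl
  · rcases h with rfl | h
    · simpa using (h2 p).1 (by simp)
    · simp [gawLoop, h]

open Classical in
/-- The initial allocation that the program computes. -/
noncomputable def startAlloc (I : AllocInstance 2 m) : Allocation 2 m := fun p =>
  if I.IsZero p then (if I.pref p 0 1 then 0 else 1)
  else if I.IsPos p then 0
  else if 0 ≤ I.v 0 p ∧ I.v 1 p ≤ 0 then 0 else 1

theorem isGAWStart_startAlloc (I : AllocInstance 2 m) : I.IsGAWStart I.startAlloc := by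
  intro p
  refine ⟨fun hz => ?_, ?_, ?_⟩
  · rw [Fin.forall_fin_two]
    by_cases h : I.pref p 0 1
    · simp [startAlloc, hz, h, I.pref_self]
    · simp [startAlloc, hz, h, I.pref_self, (I.pref_total p 0 1).resolve_left h]
  · rintro (h | h)
    · have : ¬ I.IsZero p := fun hz => h.1.ne' hz.1
      simp [startAlloc, this, h]
    · simp [startAlloc, h.1, h.2.1, h.2.2]
  · rintro (h | h)
    · have h1 : ¬ I.IsZero p := fun hz => h.1.ne hz.1
      have h2 : ¬ I.IsPos p := fun hp => hp.not_isNeg h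
      simp [startAlloc, h1, h2, h.1]
    · have h2 : ¬ I.IsPos p := fun hp => hp.1.not_ge h.2.1
      have h3 : ¬ (0 ≤ I.v 0 p ∧ I.v 1 p ≤ 0) := fun h' =>
        h.1 ⟨le_antisymm h.2.1 h'.1, le_antisymm h'.2 h.2.2⟩
      rw [startAlloc, if_neg h.1, if_neg h2, if_neg h3]

end AllocInstance

/-! ## The program

Natural-number arrays: `3` the output, `4` zero for the players that the loop may still move, `5` the
tie classes, and the variables `6` (counter), `7` (the first of the players that may be moved,
or the number of players if there is none), `8` (one if the procedure is finished). Real arrays: the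
variables `2` (gap of the current player), `3` (sum of the gaps), `4` (minimum of zero and the
gaps). -/

namespace GAWProgram

open Program

/-- The variable `x`. -/
def nvar (x : ℕ) : NatExpr := .read x (.lit 0)

/-- The real variable `x`. -/
def rvar (x : ℕ) : RealExpr := .read x (.lit 0)

/-- Both values of player `i` are positive. -/
def posTest (i : NatExpr) : Test :=
  .both (.neg (.realLe (.read 0 i) .zero)) (.neg (.realLe (.read 1 i) .zero))

/-- Both values of player `i` are negative. -/
def negTest (i : NatExpr) : Test :=
  .both (.neg (.realLe .zero (.read 0 i))) (.neg (.realLe .zero (.read 1 i)))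

/-- Both values of player `i` are zero. -/
def zeroTest (i : NatExpr) : Test :=
  .both (.both (.realLe .zero (.read 0 i)) (.realLe (.read 0 i) .zero))
    (.both (.realLe .zero (.read 1 i)) (.realLe (.read 1 i) .zero))

/-- The bit of player `i` in the array `x` is one. -/
def bitTest (x : ℕ) (i : NatExpr) : Test := .natLe (.lit 1) (.read x i)

/-- The ratio of player `i` is at most that of player `j`. -/
def ratioTest (i j : NatExpr) : Test :=
  .realLe (.times (.times (.read 0 i) (.read 1 j)) (.times (.read 0 i) (.read 1 j)))
    (.times (.times (.read 0 j) (.read 1 i)) (.times (.read 0 j) (.read 1 i)))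

/-- The key of player `i` is at most that of player `j`. -/
def keyTest (i j : NatExpr) : Test :=
  .both (ratioTest i j) (.neg (.both (ratioTest j i) (.neg (.natLe (.read 5 i) (.read 5 j)))))

/-- Stores the tie class of the current player. -/
def setTie : Program :=
  .branch (.both (posTest (nvar 6)) (.both (bitTest 2 (nvar 6)) (.neg (bitTest 1 (nvar 6)))))
    (.natStore 5 (nvar 6) (.lit 1))
    (.branch (.both (negTest (nvar 6)) (.both (bitTest 1 (nvar 6)) (.neg (bitTest 2 (nvar 6)))))
      (.natStore 5 (nvar 6) (.lit 1))
      (.branch (.both (bitTest 1 (nvar 6)) (bitTest 2 (nvar 6)))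
        (.natStore 5 (nvar 6) (.lit 2))
        (.natStore 5 (nvar 6) (.lit 3))))

/-- Marks whether the loop may move the current player. -/
def setPending : Program :=
  .branch (.both (.neg (posTest (nvar 6))) (.neg (negTest (nvar 6))))
    (.natStore 4 (nvar 6) (.lit 1))
    (.natStore 4 (nvar 6) (.lit 0))

/-- Stores the initial team of the current player. -/
def setTeam : Program :=
  .branch (zeroTest (nvar 6))
    (.branch (bitTest 1 (nvar 6)) (.natStore 3 (nvar 6) (.lit 0)) (.natStore 3 (nvar 6) (.lit 1)))
    (.branch (posTest (nvar 6)) (.natStore 3 (nvar 6) (.lit 0))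
      (.branch (.both (.realLe .zero (.read 0 (nvar 6))) (.realLe (.read 1 (nvar 6)) .zero))
        (.natStore 3 (nvar 6) (.lit 0)) (.natStore 3 (nvar 6) (.lit 1))))

/-- Goes on to the next player. -/
def increment : Program := .natStore 6 (.lit 0) (.succ (nvar 6))

/-- The treatment of one player in the initialization. -/
def initBody : Program := .seq setTie (.seq setPending (.seq setTeam increment))

/-- Computes the gap of the current player for team 2. -/
def computeGap : Program :=
  .branch (.natLe (.read 3 (nvar 6)) (.lit 0))
    (.realStore 2 (.lit 0) (.minus .zero (.read 1 (nvar 6))))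
    (.realStore 2 (.lit 0) (.read 1 (nvar 6)))

/-- Updates the sum and the minimum of the gaps. -/
def updateSum : Program :=
  .seq (.realStore 3 (.lit 0) (.plus (rvar 3) (rvar 2)))
    (.branch (.realLe (rvar 2) (rvar 4)) (.realStore 4 (.lit 0) (rvar 2)) .skip)

/-- Compares the current player with the first player found so far, and goes on to the next. -/
def updateBest : Program :=
  .seq (.branch (.both (.natLe (.read 4 (nvar 6)) (.lit 0))
      (.neg (.both (.neg (.natLe (nvar 0) (nvar 7))) (keyTest (nvar 7) (nvar 6)))))
    (.natStore 7 (.lit 0) (nvar 6)) .skip) increment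

/-- The treatment of one player in an iteration of the main loop. -/
def scanBody : Program := .seq computeGap (.seq updateSum updateBest)

/-- There are players left to be treated. -/
def counterTest : Test := .neg (.natLe (nvar 0) (nvar 6))

/-- Resets the variables of the scan. -/
def scanStart : Program :=
  .seq (.natStore 6 (.lit 0) (.lit 0)) (.seq (.natStore 7 (.lit 0) (nvar 0))
    (.seq (.realStore 3 (.lit 0) .zero) (.realStore 4 (.lit 0) .zero)))

/-- Moves the next player, or marks the procedure as finished if there is none or team 2 does not envy
team 1 by more than one player. -/
def moveOrStop : Program :=
  .branch (.both (.neg (.natLe (nvar 0) (nvar 7))) (.neg (.realLe (rvar 4) (rvar 3))))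
    (.seq (.branch (.realLe (.read 0 (nvar 7)) .zero)
      (.natStore 3 (nvar 7) (.lit 0)) (.natStore 3 (nvar 7) (.lit 1)))
      (.natStore 4 (nvar 7) (.lit 1)))
    (.natStore 8 (.lit 0) (.lit 1))

/-- An iteration of the main loop. -/
def loopBody : Program := .seq scanStart (.seq (.whileDo counterTest scanBody) moveOrStop)

/-- The procedure is not finished. -/
def stopTest : Test := .natLe (nvar 8) (.lit 0)

/-- The generalized adjusted winner procedure. -/
def program : Program :=
  .seq (.whileDo counterTest initBody) (.whileDo stopTest loopBody)

variable {m : ℕ}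

/-! ### Initialization -/

/-- The first `j` players have been treated by the initialization. -/
structure IsInit (I : AllocInstance 2 m) (j : ℕ) (s : Memory) : Prop where
  le : j ≤ m
  size : s.nat 0 0 = m
  counter : s.nat 6 0 = j
  running : s.nat 8 0 = 0
  bit1 : ∀ p : Fin m, 1 ≤ s.nat 1 p ↔ I.pref p 0 1
  bit2 : ∀ p : Fin m, 1 ≤ s.nat 2 p ↔ I.pref p 1 0
  v0 : ∀ p : Fin m, s.real 0 p = I.v 0 p
  v1 : ∀ p : Fin m, s.real 1 p = I.v 1 p
  tie : ∀ p : Fin m, (p : ℕ) < j → s.nat 5 p = I.tieClass p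
  pending : ∀ p : Fin m, (p : ℕ) < j → (s.nat 4 p = 0 ↔ I.IsPos p ∨ I.IsNeg p)
  team : ∀ p : Fin m, (p : ℕ) < j → s.nat 3 p = (I.startAlloc p : ℕ)

theorem isInit_input (I : AllocInstance 2 m) : IsInit I 0 (inputMemory I) where
  le := Nat.zero_le m
  size := by simp [inputMemory]
  counter := by simp [inputMemory]
  running := by simp [inputMemory]
  bit1 p := by
    by_cases h : I.pref p 0 1 <;> simp [inputMemory, h]
  bit2 p := by
    by_cases h : I.pref p 1 0 <;> simp [inputMemory, h]
  v0 p := by simp [inputMemory]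
  v1 p := by simp [inputMemory]
  tie p hp := by omega
  pending p hp := by omega
  team p hp := by omega

theorem wp_setTie {I : AllocInstance 2 m} {p : Fin m} {s : Memory} {Q : Memory → Prop}
    (h : IsInit I p s) (hQ : Q (s.setNat 5 p (I.tieClass p))) : setTie.wp Q s := by
  have e1 : (1 ≤ s.nat 1 p) ↔ I.pref p 0 1 := h.bit1 p
  have e2 : (1 ≤ s.nat 2 p) ↔ I.pref p 1 0 := h.bit2 p
  simp only [setTie, wp, Test.eval, posTest, negTest, bitTest, nvar, NatExpr.eval, RealExpr.eval,
    h.counter, h.v0, h.v1, e1, e2, not_le]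
  by_cases c1 : (I.IsPos p ∧ I.strictPref p 1 0) ∨ (I.IsNeg p ∧ I.strictPref p 0 1)
  · have : I.tieClass p = 1 := by simp [AllocInstance.tieClass, c1]
    rw [this] at hQ
    simp only [AllocInstance.IsPos, AllocInstance.IsNeg, AllocInstance.strictPref] at c1
    refine ⟨fun _ => hQ, fun k1 => ⟨fun _ => hQ, fun k2 => absurd c1 (not_or.2 ⟨k1, k2⟩)⟩⟩
  · have d1 := c1
    simp only [AllocInstance.IsPos, AllocInstance.IsNeg, AllocInstance.strictPref] at c1
    rw [not_or] at c1
    refine ⟨fun k => absurd k c1.1, fun _ => ⟨fun k => absurd k c1.2, fun _ => ?_⟩⟩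
    by_cases c2 : I.indiff p 0 1
    · have : I.tieClass p = 2 := by simp only [AllocInstance.tieClass, if_neg d1, if_pos c2]
      rw [this] at hQ
      exact ⟨fun _ => hQ, fun k => absurd c2 k⟩
    · have : I.tieClass p = 3 := by simp only [AllocInstance.tieClass, if_neg d1, if_neg c2]
      rw [this] at hQ
      exact ⟨fun k => absurd k c2, fun _ => hQ⟩

open Classical in
theorem wp_setPending {I : AllocInstance 2 m} {p : Fin m} {s : Memory} {Q : Memory → Prop}
    (h : IsInit I p s) (hQ : Q (s.setNat 4 p (if I.IsPos p ∨ I.IsNeg p then 0 else 1))) :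
    setPending.wp Q s := by
  simp only [setPending, wp, Test.eval, posTest, negTest, nvar, NatExpr.eval, RealExpr.eval,
    h.counter, h.v0, h.v1, not_le]
  by_cases c : I.IsPos p ∨ I.IsNeg p
  · rw [if_pos c] at hQ
    exact ⟨fun k => absurd c (not_or.2 k), fun _ => hQ⟩
  · rw [if_neg c] at hQ
    exact ⟨fun _ => hQ, fun k => absurd (not_or.1 c) k⟩

theorem wp_setTeam {I : AllocInstance 2 m} {p : Fin m} {s : Memory} {Q : Memory → Prop}
    (h : IsInit I p s) (hQ : Q (s.setNat 3 p (I.startAlloc p : ℕ))) : setTeam.wp Q s := by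
  have e1 : (1 ≤ s.nat 1 p) ↔ I.pref p 0 1 := h.bit1 p
  have z : ((0 ≤ I.v 0 p ∧ I.v 0 p ≤ 0) ∧ 0 ≤ I.v 1 p ∧ I.v 1 p ≤ 0) ↔ I.IsZero p := by
    simp only [AllocInstance.IsZero, le_antisymm_iff]
    tauto
  have ps : (0 < I.v 0 p ∧ 0 < I.v 1 p) ↔ I.IsPos p := Iff.rfl
  simp only [setTeam, wp, Test.eval, zeroTest, posTest, bitTest, nvar, NatExpr.eval, RealExpr.eval,
    h.counter, h.v0, h.v1, e1, not_le, z, ps]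
  unfold AllocInstance.startAlloc at hQ
  split_ifs at hQ with k1 k2 k3 k4 <;> simp_all

theorem lt_val_succ_iff (p q : Fin m) : (q : ℕ) < p + 1 ↔ q = p ∨ (q : ℕ) < p := by
  rw [Fin.ext_iff]; omega

/-- The three stores write to cell `p` of their arrays, about which the invariant for `p` treated
players says nothing. It therefore survives until the counter is increased. -/
theorem IsInit.step {I : AllocInstance 2 m} {j : ℕ} {s : Memory} (h : IsInit I j s) (hj : j < m) :
    initBody.wp (IsInit I (j + 1)) s := by
  classical
  obtain ⟨p, rfl⟩ : ∃ p : Fin m, (p : ℕ) = j := ⟨⟨j, hj⟩, rfl⟩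
  refine wp_setTie h ?_
  have h1 : IsInit I p (s.setNat 5 p (I.tieClass p)) :=
    { h with
      size := by simp [Memory.setNat_nat, h.size]
      counter := by simp [Memory.setNat_nat, h.counter]
      running := by simp [Memory.setNat_nat, h.running]
      bit1 := by simpa [Memory.setNat_nat] using h.bit1
      bit2 := by simpa [Memory.setNat_nat] using h.bit2
      tie := fun q hq => by simp [Memory.setNat_nat, h.tie q hq, hq.ne]
      pending := by simpa [Memory.setNat_nat] using h.pending
      team := by simpa [Memory.setNat_nat] using h.team }
  refine wp_setPending h1 ?_
  set s1 := s.setNat 5 p (I.tieClass p) with hs1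
  have h2 : IsInit I p (s1.setNat 4 p (if I.IsPos p ∨ I.IsNeg p then 0 else 1)) :=
    { h1 with
      size := by simp [Memory.setNat_nat, h1.size]
      counter := by simp [Memory.setNat_nat, h1.counter]
      running := by simp [Memory.setNat_nat, h1.running]
      bit1 := by simpa [Memory.setNat_nat] using h1.bit1
      bit2 := by simpa [Memory.setNat_nat] using h1.bit2
      tie := by simpa [Memory.setNat_nat] using h1.tie
      pending := fun q hq => by simpa [Memory.setNat_nat, hq.ne] using h1.pending q hq
      team := by simpa [Memory.setNat_nat] using h1.team }
  refine wp_setTeam h2 ?_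
  simp only [increment, wp, nvar, NatExpr.eval]
  refine ⟨hj, ?_, ?_, ?_, ?_, ?_, ?_, ?_, ?_, ?_, ?_⟩
  · simp [Memory.setNat_nat, h1.size]
  · simp [Memory.setNat_nat, h1.counter]
  · simp [Memory.setNat_nat, h1.running]
  · simpa [Memory.setNat_nat] using h1.bit1
  · simpa [Memory.setNat_nat] using h1.bit2
  · exact h.v0
  · exact h.v1
  · intro q hq
    rcases (lt_val_succ_iff p q).1 hq with rfl | hq
    · simp [Memory.setNat_nat, hs1]
    · simp [Memory.setNat_nat, h1.tie q hq]
  · intro q hq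
    rcases (lt_val_succ_iff p q).1 hq with rfl | hq
    · by_cases c : I.IsPos q ∨ I.IsNeg q <;> simp [Memory.setNat_nat, c]
    · simp [Memory.setNat_nat, hq.ne, h1.pending q hq]
  · intro q hq
    rcases (lt_val_succ_iff p q).1 hq with rfl | hq
    · simp [Memory.setNat_nat]
    · simp [Memory.setNat_nat, hq.ne, h1.team q hq]

theorem halts_init (I : AllocInstance 2 m) :
    (whileDo counterTest initBody).Halts (inputMemory I)
      (m * (initBody.bound + counterTest.cost + 1) + (counterTest.cost + 1)) (IsInit I m) := by
  have := Halts.whileDo (t := counterTest) (c := initBody) (K := initBody.bound)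
    (J := fun n s => ∃ j, IsInit I j s ∧ n + j = m) ?_ (n := m) (s := inputMemory I)
    ⟨0, isInit_input I, rfl⟩
  · refine this.mono le_rfl ?_
    rintro s ⟨⟨n, j, hj, -⟩, ht⟩
    have hle := hj.le
    simp only [counterTest, Test.eval, nvar, NatExpr.eval, hj.size, hj.counter, not_not] at ht
    rwa [le_antisymm hle ht] at hj
  · rintro n s ⟨j, hj, hn⟩ ht
    simp only [counterTest, Test.eval, nvar, NatExpr.eval, hj.size, hj.counter, not_le] at ht
    exact (hj.step ht).halts.mono le_rfl fun s' h' => ⟨n - 1, by omega, j + 1, h', by omega⟩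

/-! ### The main loop -/

/-- The memory holds the allocation `A` and the set `S` of the players that may be moved. -/
structure Holds (I : AllocInstance 2 m) (A : Allocation 2 m) (S : Finset (Fin m)) (s : Memory) :
    Prop where
  signed : ∀ p ∈ S, I.IsPos p ∨ I.IsNeg p
  size : s.nat 0 0 = m
  v0 : ∀ p : Fin m, s.real 0 p = I.v 0 p
  v1 : ∀ p : Fin m, s.real 1 p = I.v 1 p
  tie : ∀ p ∈ S, s.nat 5 p = I.tieClass p
  pending : ∀ p : Fin m, s.nat 4 p = 0 ↔ p ∈ S
  team : ∀ p : Fin m, s.nat 3 p = (A p : ℕ)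

theorem Holds.setNat {I : AllocInstance 2 m} {A : Allocation 2 m} {S : Finset (Fin m)} {s : Memory}
    (h : Holds I A S s) {x : ℕ} (hx : 6 ≤ x) (k a : ℕ) : Holds I A S (s.setNat x k a) where
  signed := h.signed
  size := by rw [Memory.setNat_nat, if_neg (by omega), h.size]
  v0 := h.v0
  v1 := h.v1
  tie p hp := by rw [Memory.setNat_nat, if_neg (by omega), h.tie p hp]
  pending p := by rw [Memory.setNat_nat, if_neg (by omega), h.pending p]
  team p := by rw [Memory.setNat_nat, if_neg (by omega), h.team p]

theorem Holds.setReal {I : AllocInstance 2 m} {A : Allocation 2 m} {S : Finset (Fin m)} {s : Memory}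
    (h : Holds I A S s) {x : ℕ} (hx : 2 ≤ x) (k : ℕ) (a : ℝ) :
    Holds I A S (s.setReal x k a) where
  signed := h.signed
  size := h.size
  v0 p := by rw [Memory.setReal_real, if_neg (by omega), h.v0 p]
  v1 p := by rw [Memory.setReal_real, if_neg (by omega), h.v1 p]
  tie := h.tie
  pending := h.pending
  team := h.team

/-- `d` is the sum of the gaps of the first `j` players and `a` is the minimum of zero and their
gaps. -/
structure IsSum (I : AllocInstance 2 m) (A : Allocation 2 m) (j : ℕ) (d a : ℝ) : Prop where
  sum : d = ∑ q ∈ Finset.univ.filter (fun q : Fin m => (q : ℕ) < j), I.gap A 1 q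
  le_zero : a ≤ 0
  le_gap : ∀ q : Fin m, (q : ℕ) < j → a ≤ I.gap A 1 q
  attained : a = 0 ∨ ∃ q : Fin m, (q : ℕ) < j ∧ a = I.gap A 1 q

theorem IsSum.step {I : AllocInstance 2 m} {A : Allocation 2 m} {p : Fin m} {d a : ℝ}
    (h : IsSum I A p d a) :
    IsSum I A (p + 1) (d + I.gap A 1 p) (if I.gap A 1 p ≤ a then I.gap A 1 p else a) where
  sum := by
    have : (Finset.univ.filter fun q : Fin m => (q : ℕ) < p + 1) =
        insert p (Finset.univ.filter fun q : Fin m => (q : ℕ) < p) := by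
      ext q
      rw [Finset.mem_filter, Finset.mem_insert, Finset.mem_filter, lt_val_succ_iff]
      simp
    rw [this, Finset.sum_insert (by simp), h.sum, add_comm]
  le_zero := by
    have := h.le_zero
    split_ifs <;> linarith
  le_gap q hq := by
    rcases (lt_val_succ_iff p q).1 hq with rfl | hq
    · split_ifs <;> linarith
    · have := h.le_gap q hq
      split_ifs <;> linarith
  attained := by
    split_ifs
    · exact Or.inr ⟨p, by omega, rfl⟩
    · rcases h.attained with h' | ⟨q, hq, h'⟩
      · exact Or.inl h'
      · exact Or.inr ⟨q, by omega, h'⟩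

/-- Since `a` is the minimum of `0` and all gaps, this one comparison covers deleting nobody and
deleting any single player. -/
theorem IsSum.noEnvy_iff {I : AllocInstance 2 m} {A : Allocation 2 m} {d a : ℝ}
    (h : IsSum I A m d a) : I.NoEnvyUpToOne A 1 0 ↔ a ≤ d := by
  have hd : d = ∑ q, I.gap A 1 q := by
    rw [h.sum]
    refine Finset.sum_congr ?_ fun _ _ => rfl
    ext q
    simp
  rw [I.noEnvyUpToOne_iff A (by decide), ← hd]
  constructor
  · rintro (h' | ⟨q, h'⟩)
    · exact h.le_zero.trans h'
    · exact (h.le_gap q q.2).trans h'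
  · intro h'
    rcases h.attained with e | ⟨q, -, e⟩
    · exact Or.inl (e ▸ h')
    · exact Or.inr ⟨q, e ▸ h'⟩

/-- `b` is a first player of `S` among the first `j` players, or the number of players if there is
none. -/
def IsBest (I : AllocInstance 2 m) (S : Finset (Fin m)) (j b : ℕ) : Prop :=
  (b = m ∧ ∀ q : Fin m, (q : ℕ) < j → q ∉ S) ∨
    ∃ p ∈ S, b = (p : ℕ) ∧ ∀ q ∈ S, (q : ℕ) < j → I.key p ≤ I.key q

/-- The first `j` players have been treated in an iteration of the main loop. -/
structure IsScan (I : AllocInstance 2 m) (A : Allocation 2 m) (S : Finset (Fin m)) (j : ℕ)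
    (s : Memory) : Prop where
  le : j ≤ m
  holds : Holds I A S s
  running : s.nat 8 0 = 0
  counter : s.nat 6 0 = j
  sum : IsSum I A j (s.real 3 0) (s.real 4 0)
  best : IsBest I S j (s.nat 7 0)

theorem isScan_start {I : AllocInstance 2 m} {A : Allocation 2 m} {S : Finset (Fin m)} {s : Memory}
    (h : Holds I A S s) (h0 : s.nat 8 0 = 0) : scanStart.wp (IsScan I A S 0) s := by
  simp only [scanStart, wp, nvar, NatExpr.eval, RealExpr.eval]
  refine ⟨Nat.zero_le m, ?_, ?_, ?_, ?_, ?_⟩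
  · exact (((h.setNat le_rfl _ _).setNat (by norm_num) _ _).setReal (by norm_num) _ _).setReal
      (by norm_num) _ _
  · simp [Memory.setNat_nat, Memory.setReal_nat, h0]
  · simp [Memory.setNat_nat, Memory.setReal_nat]
  · constructor <;> simp [Memory.setReal_real]
  · left
    simp [Memory.setNat_nat, Memory.setReal_nat, h.size]

theorem wp_computeGap {I : AllocInstance 2 m} {A : Allocation 2 m} {S : Finset (Fin m)} {p : Fin m}
    {s : Memory} {Q : Memory → Prop} (h : IsScan I A S p s)
    (hQ : Q (s.setReal 2 0 (I.gap A 1 p))) : computeGap.wp Q s := by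
  simp only [computeGap, wp, Test.eval, nvar, NatExpr.eval, RealExpr.eval, h.counter, h.holds.v1,
    h.holds.team]
  unfold AllocInstance.gap at hQ
  split_ifs at hQ with e
  · simpa [e] using hQ
  · have : A p = 0 := by omega
    simpa [this] using hQ

theorem wp_updateSum {I : AllocInstance 2 m} {A : Allocation 2 m} {S : Finset (Fin m)} {p : Fin m}
    {s : Memory} {Q : Memory → Prop} (h : IsScan I A S p s)
    (hQ : ∀ s', Holds I A S s' → s'.nat = s.nat →
      IsSum I A (p + 1) (s'.real 3 0) (s'.real 4 0) → Q s') :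
    updateSum.wp Q (s.setReal 2 0 (I.gap A 1 p)) := by
  have hs := h.sum.step
  have hh := (h.holds.setReal le_rfl 0 (I.gap A 1 p)).setReal (x := 3) (by norm_num) 0
    (s.real 3 0 + I.gap A 1 p)
  simp only [updateSum, wp, Test.eval, rvar, NatExpr.eval, RealExpr.eval]
  simp only [Memory.setReal_real]
  norm_num
  refine ⟨fun c => ?_, fun c => ?_⟩
  · rw [if_pos c] at hs
    refine hQ _ (hh.setReal (by norm_num) _ _) rfl ?_
    simpa [Memory.setReal_real] using hs
  · rw [if_neg c.not_ge] at hs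
    refine hQ _ hh rfl ?_
    simpa [Memory.setReal_real] using hs

/-- Both players must lie in `S`: this makes their values for team 2 nonzero, as
cross-multiplication requires, and their tie classes correctly stored. -/
theorem eval_keyTest {I : AllocInstance 2 m} {A : Allocation 2 m} {S : Finset (Fin m)} {s : Memory}
    (h : Holds I A S s) {p q : Fin m} (hp : p ∈ S) (hq : q ∈ S) {i j : NatExpr}
    (hi : i.eval s = p) (hj : j.eval s = q) :
    (keyTest i j).eval s ↔ I.key p ≤ I.key q := by
  have hv : ∀ r ∈ S, I.v 1 r ≠ 0 := fun r hr => by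
    rcases h.signed r hr with k | k
    · exact k.2.ne'
    · exact k.2.ne
  rw [I.key_le_key_iff, I.ratio_le_ratio (hv p hp) (hv q hq), I.ratio_le_ratio (hv q hq) (hv p hp)]
  simp only [keyTest, ratioTest, Test.eval, RealExpr.eval, NatExpr.eval, hi, hj, h.v0, h.v1,
    h.tie p hp, h.tie q hq]

theorem wp_updateBest {I : AllocInstance 2 m} {A : Allocation 2 m} {S : Finset (Fin m)} {p : Fin m}
    {s : Memory} (h : Holds I A S s) (h0 : s.nat 8 0 = 0) (hc : s.nat 6 0 = p)
    (hs : IsSum I A (p + 1) (s.real 3 0) (s.real 4 0)) (hb : IsBest I S p (s.nat 7 0)) :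
    updateBest.wp (IsScan I A S (p + 1)) s := by
  -- If no player has been found, variable `7` holds `m` and `keyTest` reads cells outside the
  -- input; the conjunct `s.nat 7 0 < m` is then false, so their contents do not matter.
  have ht : (Test.both (.natLe (.read 4 (nvar 6)) (.lit 0))
      (.neg (.both (.neg (.natLe (nvar 0) (nvar 7))) (keyTest (nvar 7) (nvar 6))))).eval s ↔
      p ∈ S ∧ ¬ (s.nat 7 0 < m ∧ (keyTest (nvar 7) (nvar 6)).eval s) := by
    simp only [Test.eval, nvar, NatExpr.eval, hc, h.size, nonpos_iff_eq_zero, h.pending, not_le]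
  simp only [updateBest, wp, ht]
  refine ⟨fun c => ?_, fun c => ?_⟩
  · simp only [increment, wp, nvar, NatExpr.eval]
    refine ⟨p.2, (h.setNat (by norm_num) _ _).setNat (by norm_num) _ _, ?_, ?_, hs, ?_⟩
    · simp [Memory.setNat_nat, h0]
    · simp [Memory.setNat_nat, hc]
    · refine Or.inr ⟨p, c.1, by simp [Memory.setNat_nat, hc], fun q hq hqp => ?_⟩
      rcases (lt_val_succ_iff p q).1 hqp with rfl | hqp
      · exact le_rfl
      · rcases hb with ⟨-, hb⟩ | ⟨r, hr, hb, hmin⟩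
        · exact absurd hq (hb q hqp)
        · have := c.2
          rw [eval_keyTest h hr c.1 (by simpa [nvar, NatExpr.eval] using hb)
            (by simpa [nvar, NatExpr.eval] using hc), hb] at this
          -- The key of `r` is not at most that of `p`, so by totality `p` comes before `r`, hence
          -- before all players that `r` precedes.
          exact (le_of_not_ge fun k => this ⟨r.2, k⟩).trans (hmin q hq hqp)
  · simp only [increment, wp, nvar, NatExpr.eval]
    refine ⟨p.2, h.setNat (by norm_num) _ _, ?_, ?_, hs, ?_⟩
    · simp [Memory.setNat_nat, h0]
    · simp [Memory.setNat_nat, hc]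
    · have e : (s.setNat 6 0 (s.nat 6 0 + 1)).nat 7 0 = s.nat 7 0 := by simp [Memory.setNat_nat]
      rw [e]
      rcases hb with ⟨hb, hn⟩ | ⟨r, hr, hb, hmin⟩
      · refine Or.inl ⟨hb, fun q hq hqS => ?_⟩
        rcases (lt_val_succ_iff p q).1 hq with rfl | hq
        · exact c ⟨hqS, fun k => by omega⟩
        · exact hn q hq hqS
      · refine Or.inr ⟨r, hr, hb, fun q hq hqp => ?_⟩
        rcases (lt_val_succ_iff p q).1 hqp with rfl | hqp
        · have := not_not.1 fun k => c ⟨hq, k⟩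
          exact (eval_keyTest h hr hq (by simpa [nvar, NatExpr.eval] using hb)
            (by simpa [nvar, NatExpr.eval] using hc)).1 this.2
        · exact hmin q hq hqp

theorem IsScan.step {I : AllocInstance 2 m} {A : Allocation 2 m} {S : Finset (Fin m)} {j : ℕ}
    {s : Memory} (h : IsScan I A S j s) (hj : j < m) : scanBody.wp (IsScan I A S (j + 1)) s := by
  obtain ⟨p, rfl⟩ : ∃ p : Fin m, (p : ℕ) = j := ⟨⟨j, hj⟩, rfl⟩
  refine wp_computeGap h (wp_updateSum h fun s' h' e hs => ?_)
  exact wp_updateBest h' (by rw [e, h.running]) (by rw [e, h.counter]) hs (by rw [e]; exact h.best)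

/-- A bound for the number of steps of an iteration of the main loop. -/
def loopBound (m : ℕ) : ℕ :=
  scanStart.bound + ((m * (scanBody.bound + counterTest.cost + 1) + (counterTest.cost + 1)) +
    moveOrStop.bound)

theorem halts_scan {I : AllocInstance 2 m} {A : Allocation 2 m} {S : Finset (Fin m)} {s : Memory}
    (h : IsScan I A S 0 s) :
    (whileDo counterTest scanBody).Halts s
      (m * (scanBody.bound + counterTest.cost + 1) + (counterTest.cost + 1)) (IsScan I A S m) := by
  have := Halts.whileDo (t := counterTest) (c := scanBody) (K := scanBody.bound)
    (J := fun n s => ∃ j, IsScan I A S j s ∧ n + j = m) ?_ (n := m) (s := s) ⟨0, h, rfl⟩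
  · refine this.mono le_rfl ?_
    rintro s ⟨⟨n, j, hj, -⟩, ht⟩
    have hle := hj.le
    simp only [counterTest, Test.eval, nvar, NatExpr.eval, hj.holds.size, hj.counter, not_not] at ht
    rwa [le_antisymm hle ht] at hj
  · rintro n s ⟨j, hj, hn⟩ ht
    simp only [counterTest, Test.eval, nvar, NatExpr.eval, hj.holds.size, hj.counter, not_le] at ht
    exact (hj.step ht).halts.mono le_rfl fun s' h' => ⟨n - 1, by omega, j + 1, h', by omega⟩

/-- The invariant of the main loop; `n` is a bound for the number of iterations to come. -/
def IsLoop (I : AllocInstance 2 m) (n : ℕ) (s : Memory) : Prop :=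
  ∃ A S, Holds I A S s ∧ (∀ A', I.CanEnd S A A' → I.IsGAWOutput A') ∧
    ((s.nat 8 0 = 0 ∧ n = S.card + 1) ∨ (s.nat 8 0 = 1 ∧ n = 0 ∧ I.IsGAWOutput A))

/-- The variant `S.card + 1` drops in both branches: a move erases a player from `S`, and stopping
resets it to `0`. -/
theorem wp_moveOrStop {I : AllocInstance 2 m} {A : Allocation 2 m} {S : Finset (Fin m)} {s : Memory}
    (h : IsScan I A S m s) (hO : ∀ A', I.CanEnd S A A' → I.IsGAWOutput A') :
    moveOrStop.wp (fun s' => ∃ n' < S.card + 1, IsLoop I n' s') s := by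
  classical
  have h' := h.holds
  have ht : (Test.both (.neg (.natLe (nvar 0) (nvar 7))) (.neg (.realLe (rvar 4) (rvar 3)))).eval s
      ↔ s.nat 7 0 < m ∧ ¬ I.NoEnvyUpToOne A 1 0 := by
    simp only [Test.eval, nvar, rvar, NatExpr.eval, RealExpr.eval, h'.size, h.sum.noEnvy_iff,
      not_le]
  simp only [moveOrStop, wp, ht]
  refine ⟨fun c => ?_, fun c => ?_⟩
  · rcases h.best with ⟨hb, -⟩ | ⟨p, hp, hb, hmin⟩
    · omega
    have key : ∀ a : Fin 2, a = (if I.IsPos p then 1 else 0) →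
        ∃ n' < S.card + 1, IsLoop I n' ((s.setNat 3 p a).setNat 4 p 1) := by
      rintro a rfl
      refine ⟨(S.erase p).card + 1, by have := Finset.card_erase_lt_of_mem hp; omega,
        Function.update A p (if I.IsPos p then 1 else 0), S.erase p, ?_, fun A' hA' => hO A'
          (hA'.step hp (fun q hq => hmin q hq q.2) c.2), Or.inl ⟨?_, rfl⟩⟩
      · refine ⟨fun q hq => h'.signed q (Finset.mem_of_mem_erase hq), ?_, h'.v0, h'.v1,
          fun q hq => ?_, fun q => ?_, fun q => ?_⟩
        · simp [Memory.setNat_nat, h'.size]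
        · simp [Memory.setNat_nat, h'.tie q (Finset.mem_of_mem_erase hq)]
        · by_cases e : q = p
          · simp [Memory.setNat_nat, e]
          · have e' : ¬ (q : ℕ) = p := fun k => e (Fin.ext k)
            simp [Memory.setNat_nat, e, e', h'.pending]
        · by_cases e : q = p
          · subst e
            simp [Memory.setNat_nat]
          · have e' : ¬ (q : ℕ) = p := fun k => e (Fin.ext k)
            simp [Memory.setNat_nat, e, e', h'.team]
      · simp [Memory.setNat_nat, h.running]
    simp only [Test.eval, nvar, NatExpr.eval, RealExpr.eval, hb, h'.v0]
    -- Players of `S` have two values of the same strict sign, so the sign of the value for team 1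
    -- decides the direction of the move.
    refine ⟨fun c1 => ?_, fun c1 => ?_⟩
    · have := key 0 (by rw [if_neg fun k : I.IsPos p => k.1.not_ge c1])
      simpa [Memory.setNat_nat, hb] using this
    · have hpos : I.IsPos p := (h'.signed p hp).resolve_right fun k => c1 k.1.le
      have := key 1 (by rw [if_pos hpos])
      simpa [Memory.setNat_nat, hb] using this
  · refine ⟨0, by omega, A, S, h'.setNat (by norm_num) _ _, hO, Or.inr ⟨?_, rfl, ?_⟩⟩
    · simp [Memory.setNat_nat, NatExpr.eval]
    · refine hO A (I.canEnd_self S A ?_)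
      rcases h.best with ⟨-, hb⟩ | ⟨p, hp, hb, -⟩
      · exact Or.inl (Finset.eq_empty_of_forall_notMem fun q => hb q q.2)
      · exact Or.inr (not_not.1 fun k => c ⟨hb ▸ p.2, k⟩)

theorem IsLoop.step {I : AllocInstance 2 m} {n : ℕ} {s : Memory} (h : IsLoop I n s)
    (ht : stopTest.eval s) : loopBody.Halts s (loopBound m) fun s' => ∃ n' < n, IsLoop I n' s' := by
  simp only [stopTest, Test.eval, nvar, NatExpr.eval] at ht
  obtain ⟨A, S, hh, hO, ⟨h0, rfl⟩ | ⟨h1, -⟩⟩ := h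
  · exact (isScan_start hh h0).halts.seq fun s' h' => (halts_scan h').seq fun s'' h'' =>
      (wp_moveOrStop h'' hO).halts
  · omega

theorem IsInit.isLoop {I : AllocInstance 2 m} {s : Memory} (h : IsInit I m s) :
    ∃ n ≤ m + 1, IsLoop I n s := by
  classical
  refine ⟨(Finset.univ.filter fun p => I.IsPos p ∨ I.IsNeg p).card + 1, ?_, I.startAlloc,
    Finset.univ.filter fun p => I.IsPos p ∨ I.IsNeg p, ?_, fun A' hA' =>
    hA'.isGAWOutput (by simp) I.isGAWStart_startAlloc, Or.inl ⟨h.running, rfl⟩⟩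
  · simpa using Finset.card_filter_le (Finset.univ : Finset (Fin m)) _
  · exact ⟨by simp, h.size, h.v0, h.v1, fun p _ => h.tie p p.2,
      fun p => by simp [h.pending p p.2], fun p => h.team p p.2⟩

/-! ### The running time. -/

/-- A bound for the number of steps of the program. -/
def totalBound (m : ℕ) : ℕ :=
  (m * (initBody.bound + counterTest.cost + 1) + (counterTest.cost + 1)) +
    ((m + 1) * (loopBound m + stopTest.cost + 1) + (stopTest.cost + 1))

theorem halts_program (I : AllocInstance 2 m) :
    program.Halts (inputMemory I) (totalBound m)
      fun s => ∃ A, HoldsOutput s A ∧ I.IsGAWOutput A := by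
  refine (halts_init I).seq fun s hs => ?_
  obtain ⟨n, hn, hl⟩ := hs.isLoop
  refine (Halts.whileDo (fun n s h ht => IsLoop.step h ht) hl).mono ?_ ?_
  · exact Nat.add_le_add_right (Nat.mul_le_mul_right _ hn) _
  · rintro s' ⟨⟨n', A, S, hh, -, ⟨h0, -⟩ | ⟨-, -, hA⟩⟩, ht⟩
    · simp [stopTest, Test.eval, nvar, NatExpr.eval, h0] at ht
    · exact ⟨A, hh.team, hA⟩

theorem exists_totalBound_le : ∃ C : ℕ, ∀ m, totalBound m ≤ C * (m + 1) ^ 2 := by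
  have key : ∀ a b c d e m : ℕ,
      (m * a + b) + ((m + 1) * (c + m * d) + e) ≤ (a + b + c + d + e) * (m + 1) ^ 2 := by
    intro a b c d e m
    -- The witness is the difference of the two sides, collected by coefficient; all its terms are
    -- natural numbers.
    refine Nat.le.intro (k := a * (m ^ 2 + m + 1) + b * (m ^ 2 + 2 * m) + c * (m ^ 2 + m) +
      d * (m + 1) + e * (m ^ 2 + 2 * m)) ?_
    ring
  refine ⟨_, fun m => le_trans (le_of_eq ?_) (key (initBody.bound + counterTest.cost + 1)
    (counterTest.cost + 1) (scanStart.bound + (counterTest.cost + 1) + moveOrStop.bound +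
      stopTest.cost + 1) (scanBody.bound + counterTest.cost + 1) (stopTest.cost + 1) m)⟩
  rw [totalBound, loopBound]
  ring

theorem isBigO_totalBound :
    (fun m : ℕ => (totalBound m : ℝ)) =O[Filter.atTop] (fun m : ℕ => (m : ℝ) ^ 2) := by
  obtain ⟨C, hC⟩ := exists_totalBound_le
  refine Asymptotics.IsBigO.of_bound (C * 4) ?_
  filter_upwards [Filter.eventually_ge_atTop 1] with m hm
  rw [Real.norm_of_nonneg (Nat.cast_nonneg _), Real.norm_of_nonneg (by positivity)]
  -- The factor `4` comes from `m + 1 ≤ 2 * m` for `m ≥ 1`.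
  have h1 : totalBound m ≤ C * 4 * m ^ 2 := by
    refine (hC m).trans ?_
    rw [mul_assoc]
    exact Nat.mul_le_mul_left _ (by nlinarith)
  exact_mod_cast h1

end GAWProgram

end TeamAllocation

theorem theorem4 :
    (∀ (m : ℕ) (I : AllocInstance 2 m) (A : Allocation 2 m),
      I.IsGAWOutput A → I.EF1 A ∧ I.PO A ∧ I.TeamPO A) ∧
    ∃ (c : Program) (T : ℕ → ℕ),
      (fun m : ℕ => (T m : ℝ)) =O[Filter.atTop] (fun m : ℕ => (m : ℝ) ^ 2) ∧
      ∀ (m : ℕ) (I : AllocInstance 2 m), ∃ (k : ℕ) (s : Memory) (A : Allocation 2 m),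
        Exec c (inputMemory I) k s ∧ k ≤ T m ∧ HoldsOutput s A ∧
        I.IsGAWOutput A ∧ I.EF1 A ∧ I.PO A ∧ I.TeamPO A := by
  refine ⟨fun m I A h => h.fair, GAWProgram.program, GAWProgram.totalBound,
    GAWProgram.isBigO_totalBound, fun m I => ?_⟩
  obtain ⟨k, s, hk, he, A, hA, hO⟩ := GAWProgram.halts_program I
  exact ⟨k, s, A, he, hk, hA, hO, hO.fair⟩
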